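/- Let $n\ge 2$. Let $\mathcal K_o^n$ be the set of convex bodies $K\subset\mathbb R^n$ (compact convex sets with non-empty interior) that contain the origin $o$. For $x\in\partial K$ let $N(x)$ be an outer unit normal of $K$ at $x$, let $k_1(x)\le\dots\le k_{n-1}(x)$ be the generalized principal curvatures of $\partial K$ at $x$ (the eigenvalues of the generalized second derivative, which exists for almost every $x\in\partial K$), and let $H_{n-1}=\prod_{i=1}^{n-1}k_i$ be the Gauss curvature; $\mathcal H^{n-1}$ is the surface area measure. Let $\mathcal C^n$ be the class of all $K\in\mathcal K^n_o$ that admit an inner rolling ball (there is $r>0$ with $B(x-rN(x),r)\subseteq K$ for all $x\in\partial K$) and an outer rolling ball (there is $R>0$ with $K\subseteq B(x-RN(x),R)$ for all $x\in\partial K$). A functional $\Phi$ is called a valuation on a class $\mathcal S$ of convex bodies if $\Phi(K\cup L)+\Phi(K\cap L)=\Phi(K)+\Phi(L)$ for all $K,L\in\mathcal S$ such that $K\cup L$ is convex. Let $p\in\mathbb R$ with $p\ge 0$ or $p<-n$, let $m,k\in\mathbb N\cup\{0\}$, $j\in\mathbb N\cup\{0\}$, $1\le i_1,\dots,i_j\le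 n-1$ and $\alpha_1,\dots,\alpha_j\ge 0$. Then $$\Phi(K)=\int_{\partial K}\langle x,N(x)\rangle^{\,m-k+\frac{n(1-p)}{n+p}}\,H_{n-1}(x)^{\frac p{n+p}}\prod_{l=1}^{j}k_{i_l}(x)^{\alpha_l}\,d\mathcal H^{n-1}(x)$$ is a valuation on $\mathcal C^n$ with values in $[0,\infty]$. If $o$ is an interior point of $K\in\mathcal C^n$, the integrand is integrable; so $\Phi$ is a real-valued valuation on the class of those $K\in\mathcal C^n$ that have $o$ as an interior point. Moreover, for every $s\ge 0$ the mixed affine surface area $$as_{1,s}(K)=\int_{\partial K}H_{n-1}(x)^{\frac{s+1}{n+1}}\,d\mathcal H^{n-1}(x)$$ is finite for every $K\in\mathcal C^n$ and is a (real-valued) valuation on $\mathcal C^n$. -/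

import Mathlib

open MeasureTheory Topology Asymptotics

namespace LpSteiner

/-- Euclidean space `ℝⁿ`. -/
abbrev E (n : ℕ) : Type := EuclideanSpace ℝ (Fin n)

/-- `u` is an outer unit normal vector of `K` at `x`. -/
def IsOuterUnitNormal {n : ℕ} (K : Set (E n)) (x u : E n) : Prop :=
  ‖u‖ = 1 ∧ ∀ y ∈ K, inner ℝ (y - x) u ≤ 0

open Classical in
/-- `N_K(x)`: an outer unit normal vector of `K` at `x`. For a convex body with interior points it
is unique at almost every boundary point. The value is `0` where no normal exists; this happens at
no boundary point of a convex body. -/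
noncomputable def outerNormal {n : ℕ} (K : Set (E n)) (x : E n) : E n :=
  if h : ∃ u, IsOuterUnitNormal K x u then h.choose else 0

/-- `K` admits an inner rolling ball: for some `r > 0`, at every boundary point `x` the ball
`B(x - r N(x), r)` is contained in `K`. -/
def AdmitsInnerRollingBall {n : ℕ} (K : Set (E n)) : Prop :=
  ∃ r : ℝ, 0 < r ∧ ∀ x ∈ frontier K, ∀ u, IsOuterUnitNormal K x u →
    Metric.closedBall (x - r • u) r ⊆ K

/-- `K` admits an outer rolling ball: for some `R > 0`, at every boundary point `x` the ball
`B(x - R N(x), R)` contains `K`. -/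
def AdmitsOuterRollingBall {n : ℕ} (K : Set (E n)) : Prop :=
  ∃ R : ℝ, 0 < R ∧ ∀ x ∈ frontier K, ∀ u, IsOuterUnitNormal K x u →
    K ⊆ Metric.closedBall (x - R • u) R

/-- The class `𝒞ⁿ` of convex bodies in `ℝⁿ` that contain the origin and admit an inner and an
outer rolling ball. (An inner rolling ball forces the interior to be non-empty.) -/
def rollingBodies (n : ℕ) : Set (ConvexBody (E n)) :=
  {K | (0 : E n) ∈ K ∧ AdmitsInnerRollingBall (K : Set (E n)) ∧
    AdmitsOuterRollingBall (K : Set (E n))}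

/-- `κ` lists, in increasing order and with multiplicity, the (generalized) principal curvatures of
`∂K` at `x`: there is an orthonormal basis `e` of the tangent hyperplane `N(x)^⊥` (the principal
directions) such that `∂K` has the second order expansion
`⟨x - y, N(x)⟩ = ½ ∑ κ_i ⟨e_i, y - x⟩² + o(‖y - x‖²)` for `y → x` in `∂K`.
That is, `κ` are the eigenvalues of the generalized second derivative at `x` of the function whose
graph over the tangent hyperplane is `∂K` near `x`. -/
def IsPrincipalCurvatures {n : ℕ} (K : Set (E n)) (x : E n) (κ : Fin (n - 1) → ℝ) : Prop :=
  Monotone κ ∧ ∃ e : Fin (n - 1) → E n, Orthonormal ℝ e ∧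
    (∀ i, inner ℝ (e i) (outerNormal K x) = 0) ∧
    (fun y => inner ℝ (x - y) (outerNormal K x) - (1 / 2) * ∑ i, κ i * inner ℝ (e i) (y - x) ^ 2)
      =o[𝓝[frontier K] x] fun y => ‖y - x‖ ^ 2

open Classical in
/-- The principal curvatures `k_1(x) ≤ … ≤ k_{n-1}(x)` of `K` at `x` (`k_i` has index `i - 1`).
They exist at almost every boundary point of a convex body with interior points; where they do
not exist, the value is `0`. -/
noncomputable def principalCurvature {n : ℕ} (K : Set (E n)) (x : E n) : Fin (n - 1) → ℝ :=
  if h : ∃ κ, IsPrincipalCurvatures K x κ then h.choose else 0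

/-- The Gauss curvature `H_{n-1}(x)`. -/
noncomputable def gaussCurvature {n : ℕ} (K : Set (E n)) (x : E n) : ℝ :=
  ∏ i, principalCurvature K x i

/-- The integrand
`⟨x, N(x)⟩^{m - k + n(1-p)/(n+p)} H_{n-1}(x)^{p/(n+p)} ∏_l k_{i_l}(x)^{α_l}`. -/
noncomputable def curvatureIntegrand {n : ℕ} (p : ℝ) (m k : ℕ) {j : ℕ} (i : Fin j → Fin (n - 1))
    (α : Fin j → ℝ) (K : Set (E n)) (x : E n) : ℝ :=
  inner ℝ x (outerNormal K x) ^ ((m : ℝ) - (k : ℝ) + n * (1 - p) / (n + p)) *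
    gaussCurvature K x ^ (p / (n + p)) * ∏ l, principalCurvature K x (i l) ^ α l

/-- The integrand `H_{n-1}(x)^{(s+p)/(n+p)} ⟨x, N(x)⟩^{(1-p)(n-s)/(n+p)}` of the mixed `L_p` affine
surface area. -/
noncomputable def mixedAffineIntegrand {n : ℕ} (p s : ℝ) (K : Set (E n)) (x : E n) : ℝ :=
  gaussCurvature K x ^ ((s + p) / (n + p)) *
    inner ℝ x (outerNormal K x) ^ ((1 - p) * ((n - s) / (n + p)))

/-- The `s`-th mixed `L_p` affine surface area `as_{p,s}(K)`. -/
noncomputable def mixedAffineSurfaceArea {n : ℕ} (p s : ℝ) (K : ConvexBody (E n)) : ℝ :=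
  ∫ x in frontier (K : Set (E n)), mixedAffineIntegrand p s (K : Set (E n)) x ∂μHE[n - 1]

/-- `Φ` is a valuation on the class `𝒮` of convex bodies:
`Φ(K ∪ L) + Φ(K ∩ L) = Φ(K) + Φ(L)` for all `K, L ∈ 𝒮` such that `K ∪ L` (and then also `K ∩ L`)
is a convex body. -/
def IsValuationOn {n : ℕ} {M : Type*} [Add M] (𝒮 : Set (ConvexBody (E n)))
    (Φ : ConvexBody (E n) → M) : Prop :=
  ∀ K ∈ 𝒮, ∀ L ∈ 𝒮, ∀ U I : ConvexBody (E n),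
    (U : Set (E n)) = (K : Set (E n)) ∪ L → (I : Set (E n)) = (K : Set (E n)) ∩ L →
      Φ U + Φ I = Φ K + Φ L

end LpSteiner

namespace LpSteiner

open Filter Set Metric

/-! The integrands depend on a body only through its normal and principal curvatures at the point.
The boundaries of `K`, `L`, `K ∪ L`, `K ∩ L` are built from five pieces: `∂K \ L`, `∂L \ K`, `∂K ∩
int L`, `∂L ∩ int K` and `A = ∂K ∩ ∂L`. On the first four, the bodies involved coincide near each
point. So the valuation identity reduces to two claims about `A`: it lies in `∂(K ∪ L)`, and almost
everywhere on it all four bodies have the same normal and curvatures.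

The first claim comes from the outer balls (`frontier_inter_frontier_subset`). For the second, an
inner ball at `x` makes the normal unique and bounds slopes near `x` by a multiple of the distance
to `x` (`abs_inner_sub_le`). By Lebesgue's density theorem in Lipschitz charts, at almost every `x ∈
A` every nearby boundary point `y` has a point of `A` within `o(‖y - x‖)` (`ae_firstOrderDense`).
The slope bound makes the resulting change of height `o(‖y - x‖²)`, so a second order expansion
along `A` is equivalent to one along the whole boundary
(`hasSecondOrderExpansion_iff_of_firstOrderDense`). As `A` is common to all the bodies, the
curvatures agree.

For integrability, inner balls of radius `r` give curvatures in `[0, 2/r]` and finite boundary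
measure. Measurability follows by writing the points with curvatures in a closed set as a countable
intersection of countable unions of compact sets. -/

/-! ### Outer normals at points touched by an inner ball -/

theorem norm_outerNormal_sub_le {n : ℕ} {M : Set (E n)} {x u y v : E n} {r : ℝ} (hr : 0 < r)
    (hu : IsOuterUnitNormal M x u) (hb : closedBall (x - r • u) r ⊆ M) (hy : y ∈ M)
    (hv : IsOuterUnitNormal M y v) : r * ‖v - u‖ ≤ 2 * ‖y - x‖ := by
  -- The point of the inner ball extreme in direction `v`. Testing `v` on it gives `r (1 - ⟨u, v⟩) ≤
  -- ⟨y - x, v - u⟩`, whose left side is `r ‖v - u‖² / 2`.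
  have hz : x - r • u + r • v ∈ M := hb (by
    rw [mem_closedBall, dist_eq_norm, add_sub_cancel_left, norm_smul, hv.1, Real.norm_eq_abs,
      abs_of_pos hr, mul_one])
  have h1 := hv.2 _ hz
  have h2 := hu.2 _ hy
  have hvv : inner ℝ v v = (1 : ℝ) := by simp [hv.1]
  have h3 : inner ℝ (x - r • u + r • v - y) v = - inner ℝ (y - x) v - r * inner ℝ u v + r := by
    have : x - r • u + r • v - y = -(y - x) - r • u + r • v := by abel
    rw [this, inner_add_left, inner_sub_left, inner_neg_left, real_inner_smul_left,
      real_inner_smul_left, hvv, mul_one]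
  have h4 : ‖v - u‖ ^ 2 = 2 * (1 - inner ℝ u v) := by
    rw [norm_sub_sq_real, hv.1, hu.1, real_inner_comm]; ring
  have h5 : inner ℝ (y - x) (v - u) ≤ ‖y - x‖ * ‖v - u‖ := real_inner_le_norm _ _
  rw [inner_sub_right] at h5
  rcases (norm_nonneg (v - u)).eq_or_lt with h0 | h0
  · rw [← h0]; simp
  · refine le_of_mul_le_mul_right ?_ h0
    nlinarith

theorem IsOuterUnitNormal.eq_of_ball {n : ℕ} {M : Set (E n)} {x u v : E n} {r : ℝ} (hr : 0 < r)
    (hu : IsOuterUnitNormal M x u) (hb : closedBall (x - r • u) r ⊆ M) (hx : x ∈ M)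
    (hv : IsOuterUnitNormal M x v) : v = u := by
  have h := norm_outerNormal_sub_le hr hu hb hx hv
  rw [sub_self, norm_zero, mul_zero] at h
  have : ‖v - u‖ ≤ 0 := by
    by_contra! h'
    nlinarith [mul_pos hr h']
  exact sub_eq_zero.1 (norm_le_zero_iff.1 this)

theorem exists_unit_separating {n : ℕ} {M : Set (E n)} (hc : Convex ℝ M) (hcl : IsClosed M)
    (hne : M.Nonempty) {z : E n} (hz : z ∉ M) :
    ∃ u : E n, ‖u‖ = 1 ∧ ∀ y ∈ M, inner ℝ (y - z) u ≤ 0 := by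
  obtain ⟨f, c, h1, h2⟩ := geometric_hahn_banach_closed_point hc hcl hz
  set w := (InnerProductSpace.toDual ℝ (E n)).symm f with hw
  have hf : ∀ y, inner ℝ w y = f y := fun y => InnerProductSpace.toDual_symm_apply
  have hw0 : w ≠ 0 := by
    obtain ⟨y, hy⟩ := hne
    intro h0
    have h3 := h1 y hy
    rw [← hf, h0, inner_zero_left] at h3
    rw [← hf, h0, inner_zero_left] at h2
    linarith
  refine ⟨‖w‖⁻¹ • w, by simp [norm_smul, hw0], fun y hy => ?_⟩
  rw [real_inner_smul_right, real_inner_comm, inner_sub_right, hf, hf]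
  have := h1 y hy
  exact mul_nonpos_of_nonneg_of_nonpos (by positivity) (by linarith)

theorem isClosed_setOf_isOuterUnitNormal {n : ℕ} (M : Set (E n)) :
    IsClosed {q : E n × E n | IsOuterUnitNormal M q.1 q.2} := by
  simp only [IsOuterUnitNormal, ofPred_and, ofPred_forall]
  refine (isClosed_eq (by fun_prop) (by fun_prop)).inter ?_
  exact isClosed_iInter fun y => isClosed_iInter fun _ =>
    isClosed_le (by fun_prop) continuous_const

/-- Exterior points tending to `x` are separated from `M` by unit directions; a limit of these along
a subsequence is normal at `x`. -/
theorem exists_isOuterUnitNormal {n : ℕ} {M : Set (E n)} (hc : Convex ℝ M) (hcl : IsClosed M)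
    {x : E n} (hx : x ∈ frontier M) : ∃ u, IsOuterUnitNormal M x u := by
  have hne : M.Nonempty := ⟨x, hcl.frontier_subset hx⟩
  have hx' : x ∈ closure Mᶜ := by
    rw [frontier_eq_closure_inter_closure] at hx; exact hx.2
  obtain ⟨z, hz, hlim⟩ := mem_closure_iff_seq_limit.1 hx'
  choose u hu1 hu2 using fun k => exists_unit_separating hc hcl hne (hz k)
  obtain ⟨v, -, φ, hφ, hv⟩ := (isCompact_sphere (0 : E n) 1).tendsto_subseq
    (x := u) (fun k => by simp [hu1])
  have hz' := hlim.comp hφ.tendsto_atTop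
  refine ⟨v, tendsto_nhds_unique hv.norm (by simp [hu1]), fun y hy => ?_⟩
  refine le_of_tendsto ((tendsto_const_nhds.sub hz').inner hv)
    (Eventually.of_forall fun k => hu2 _ y hy)

theorem outerNormal_spec {n : ℕ} {M : Set (E n)} (hc : Convex ℝ M) (hcl : IsClosed M)
    {x : E n} (hx : x ∈ frontier M) : IsOuterUnitNormal M x (outerNormal M x) := by
  have h := exists_isOuterUnitNormal hc hcl hx
  rw [outerNormal, dif_pos h]
  exact h.choose_spec

/-- The normal at `a` gives `⟨y - a, v⟩ ≤ 0` and differs from `u` by at most `2‖a - x‖ / r`;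
exchanging `y` and `a` gives the other sign. This is the `C^{1,1}` property of the boundary at `x`.
-/
theorem abs_inner_sub_le {n : ℕ} {M : Set (E n)} (hc : Convex ℝ M) (hcl : IsClosed M)
    {x u y a : E n} {r : ℝ} (hr : 0 < r)
    (hu : IsOuterUnitNormal M x u) (hb : closedBall (x - r • u) r ⊆ M) (hy : y ∈ frontier M)
    (ha : a ∈ frontier M) :
    r * |inner ℝ (y - a) u| ≤ 2 * ‖y - a‖ * (‖y - x‖ + ‖a - x‖) := by
  have key : ∀ y ∈ frontier M, ∀ a ∈ frontier M,
      r * inner ℝ (y - a) u ≤ 2 * ‖y - a‖ * ‖a - x‖ := by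
    intro y hy a ha
    have hv := outerNormal_spec hc hcl ha
    set v := outerNormal M a
    have h1 := norm_outerNormal_sub_le hr hu hb (hcl.frontier_subset ha) hv
    have h2 := hv.2 y (hcl.frontier_subset hy)
    have h3 : inner ℝ (y - a) (u - v) ≤ ‖y - a‖ * ‖u - v‖ := real_inner_le_norm _ _
    rw [inner_sub_right, norm_sub_rev u v] at h3
    have h4 : ‖y - a‖ * (r * ‖v - u‖) ≤ ‖y - a‖ * (2 * ‖a - x‖) :=
      mul_le_mul_of_nonneg_left h1 (norm_nonneg _)
    nlinarith
  have h1 := key y hy a ha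
  have h2 := key a ha y hy
  rw [← neg_sub y a, inner_neg_left, norm_neg] at h2
  have h3 : 0 ≤ ‖y - a‖ * ‖a - x‖ := by positivity
  have h4 : 0 ≤ ‖y - a‖ * ‖y - x‖ := by positivity
  rcases abs_cases (inner ℝ (y - a) u) with h | h <;> rw [h.1] <;> nlinarith

/-! ### Boundary points over the tangent hyperplane -/

theorem exists_frontier_mem_segment {n : ℕ} {M : Set (E n)} (hcl : IsClosed M) {p q : E n}
    (hp : p ∈ M) (hq : q ∉ M) : ∃ y ∈ segment ℝ p q, y ∈ frontier M := by
  by_contra! h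
  have hpre : IsPreconnected (segment ℝ p q) := (convex_segment p q).isPreconnected
  have hcov : segment ℝ p q ⊆ interior M ∪ Mᶜ := by
    intro y hy
    by_cases hyM : y ∈ M
    · left
      by_contra hi
      exact h y hy ⟨subset_closure hyM, hi⟩
    · exact Or.inr hyM
  obtain ⟨y, -, hy1, hy2⟩ := hpre _ _ isOpen_interior hcl.isOpen_compl hcov
    ⟨p, left_mem_segment ℝ p q, (hcov (left_mem_segment ℝ p q)).resolve_right (fun h => h hp)⟩
    ⟨q, right_mem_segment ℝ p q, hq⟩
  exact hy2 (interior_subset hy1)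

theorem exists_frontier_over_tangent {n : ℕ} {M : Set (E n)} (hcl : IsClosed M)
    {x u w : E n} {r : ℝ} (hr : 0 < r)
    (hu : IsOuterUnitNormal M x u) (hb : closedBall (x - r • u) r ⊆ M)
    (hw : inner ℝ w u = 0) (hwr : ‖w‖ ≤ r) :
    ∃ s : ℝ, 0 ≤ s ∧ s ≤ ‖w‖ ^ 2 / r ∧ x + w - s • u ∈ frontier M := by
  have huu : inner ℝ u u = (1 : ℝ) := by simp [hu.1]
  -- At depth `T` the point lies in the inner ball, since `‖w‖² + (r - T)² = r² - T (r - T)` and `T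
  -- ≤ r`. One unit above the hyperplane lies outside `M`, so the boundary is crossed in between.
  set T := ‖w‖ ^ 2 / r with hT
  have hTr : T ≤ r := by
    rw [hT, div_le_iff₀ hr]; nlinarith [norm_nonneg w]
  have hT0 : 0 ≤ T := by positivity
  have hrT : r * T = ‖w‖ ^ 2 := by rw [hT]; field_simp
  have hp : x + w - T • u ∈ M := by
    refine hb ?_
    rw [mem_closedBall, dist_eq_norm]
    have h1 : x + w - T • u - (x - r • u) = w + (r - T) • u := by rw [sub_smul]; abel
    rw [h1]
    refine abs_le_of_sq_le_sq' ?_ hr.le |>.2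
    rw [norm_add_sq_real, real_inner_smul_right, hw, norm_smul, hu.1, Real.norm_eq_abs, mul_one,
      sq_abs]
    nlinarith
  have hq : x + w + (1 : ℝ) • u ∉ M := by
    intro h
    have := hu.2 _ h
    rw [show x + w + (1 : ℝ) • u - x = w + (1 : ℝ) • u by abel, inner_add_left, hw,
      real_inner_smul_left, huu] at this
    linarith
  obtain ⟨y, ⟨a, b, ha, hb', hab, rfl⟩, hy⟩ := exists_frontier_mem_segment hcl hp hq
  have hyeq : a • (x + w - T • u) + b • (x + w + (1 : ℝ) • u) = x + w - (a * T - b) • u := by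
    have : a = 1 - b := by linarith
    subst this
    module
  rw [hyeq] at hy
  refine ⟨a * T - b, ?_, ?_, hy⟩
  · have := hu.2 _ (hcl.frontier_subset hy)
    rw [show x + w - (a * T - b) • u - x = w - (a * T - b) • u by abel, inner_sub_left, hw,
      real_inner_smul_left, huu] at this
    linarith
  · nlinarith

/-! ### Uniqueness and bounds of principal curvatures -/

theorem exists_orthonormalBasis_option {n : ℕ} (hn : 1 ≤ n) {u : E n} (hu : ‖u‖ = 1) :
    ∃ b : OrthonormalBasis (Option (Fin (n - 1))) ℝ (E n), b none = u := by
  have hcard : Module.finrank ℝ (E n) = Fintype.card (Option (Fin (n - 1))) := by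
    simp; omega
  have ho : Orthonormal ℝ (({none} : Set (Option (Fin (n - 1)))).domRestrict fun _ => u) := by
    refine ⟨fun _ => hu, fun i j hij => ?_⟩
    exact absurd (Subsingleton.elim i j) hij
  obtain ⟨b, hb⟩ := ho.exists_orthonormalBasis_extension_of_card_eq hcard
  exact ⟨b, hb none rfl⟩

theorem norm_sq_eq_sum_of_orthonormal {n : ℕ} (hn : 1 ≤ n) {u : E n} (hu : ‖u‖ = 1)
    {e : Fin (n - 1) → E n} (he : Orthonormal ℝ e) (heu : ∀ i, inner ℝ (e i) u = 0)
    {w : E n} (hw : inner ℝ w u = 0) : ‖w‖ ^ 2 = ∑ i, inner ℝ (e i) w ^ 2 := by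
  have hcard : Fintype.card (Option (Fin (n - 1))) = Module.finrank ℝ (E n) := by
    simp; omega
  let g : Option (Fin (n - 1)) → E n := fun o => o.elim u e
  have hg : Orthonormal ℝ g := by
    refine ⟨fun o => ?_, fun o o' h => ?_⟩
    · cases o with
      | none => exact hu
      | some i => exact he.1 i
    · cases o with
      | none =>
        cases o' with
        | none => exact absurd rfl h
        | some j => exact (real_inner_comm _ _).trans (heu j)
      | some i =>
        cases o' with
        | none => exact heu i
        | some j => exact he.2 (fun hij => h (by rw [hij]))
  let b := (basisOfOrthonormalOfCardEqFinrank hg hcard).toOrthonormalBasis (by simpa using hg)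
  have h := b.sum_sq_norm_inner_right w
  rw [← h, Fintype.sum_option]
  simp [b, g, real_inner_comm w u, hw]

theorem principal_values_le {n : ℕ} (hn : 1 ≤ n) {u : E n} (hu : ‖u‖ = 1)
    {e e' : Fin (n - 1) → E n} (he : Orthonormal ℝ e) (heu : ∀ i, inner ℝ (e i) u = 0)
    (he' : Orthonormal ℝ e') (heu' : ∀ i, inner ℝ (e' i) u = 0) {κ κ' : Fin (n - 1) → ℝ}
    (hκ : Monotone κ) (hκ' : Monotone κ')
    (h : ∀ w, inner ℝ w u = 0 →
      ∑ i, κ i * inner ℝ (e i) w ^ 2 = ∑ i, κ' i * inner ℝ (e' i) w ^ 2) (i : Fin (n - 1)) :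
    κ' i ≤ κ i := by
  by_contra! hlt
  -- Courant–Fischer: `n - 1` linear conditions on an `n`-dimensional space have a nonzero solution
  -- `w`. The slot `i` is free and is used to make `w` tangent. On `w` the common form is at most `κ
  -- i ‖w‖²` and at least `κ' i ‖w‖²`.
  let φ : E n →ₗ[ℝ] (Fin (n - 1) → ℝ) := LinearMap.pi fun j =>
    (innerSL ℝ (if j < i then e' j else if j = i then u else e j)).toLinearMap
  have hker : LinearMap.ker φ ≠ ⊥ := LinearMap.ker_ne_bot_of_finrank_lt (by simp; omega)
  obtain ⟨w, hwk, hw0⟩ := Submodule.exists_mem_ne_zero_of_ne_bot hker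
  have hφ : ∀ j, inner ℝ (if j < i then e' j else if j = i then u else e j) w = 0 :=
    fun j => congrFun (LinearMap.mem_ker.1 hwk) j
  have hwu : inner ℝ w u = 0 := by
    have := hφ i
    rw [if_neg (lt_irrefl i), if_pos rfl] at this
    rw [real_inner_comm]; exact this
  have h1 : ∑ j, κ j * inner ℝ (e j) w ^ 2 ≤ κ i * ‖w‖ ^ 2 := by
    rw [norm_sq_eq_sum_of_orthonormal hn hu he heu hwu, Finset.mul_sum]
    refine Finset.sum_le_sum fun j _ => ?_
    rcases le_or_gt j i with hj | hj
    · exact mul_le_mul_of_nonneg_right (hκ hj) (sq_nonneg _)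
    · have := hφ j
      rw [if_neg hj.not_gt, if_neg hj.ne'] at this
      simp [this]
  have h2 : κ' i * ‖w‖ ^ 2 ≤ ∑ j, κ' j * inner ℝ (e' j) w ^ 2 := by
    rw [norm_sq_eq_sum_of_orthonormal hn hu he' heu' hwu, Finset.mul_sum]
    refine Finset.sum_le_sum fun j _ => ?_
    rcases lt_or_ge j i with hj | hj
    · have := hφ j
      rw [if_pos hj] at this
      simp [this]
    · exact mul_le_mul_of_nonneg_right (hκ' hj) (sq_nonneg _)
  have h3 : 0 < ‖w‖ ^ 2 := by positivity
  rw [h w hwu] at h1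
  nlinarith

/-- Second order expansion of the set `A` at its point `x` with normal `u`, along `A`. -/
def HasSecondOrderExpansion {n : ℕ} (A : Set (E n)) (x u : E n) (κ : Fin (n - 1) → ℝ) : Prop :=
  Monotone κ ∧ ∃ e : Fin (n - 1) → E n, Orthonormal ℝ e ∧ (∀ i, inner ℝ (e i) u = 0) ∧
    (fun y => inner ℝ (x - y) u - (1 / 2) * ∑ i, κ i * inner ℝ (e i) (y - x) ^ 2)
      =o[𝓝[A] x] fun y => ‖y - x‖ ^ 2

/-- Along a curve in `A` over the ray `x + t w` whose depth is `O(t²)`, one has `‖y - x‖ = O(t)`, so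
the error is `o(t²)`. Thus the heights alone determine the quadratic form. -/
theorem tendsto_height_div_sq {n : ℕ} {A : Set (E n)} {x u w : E n} (hu : ‖u‖ = 1)
    {κ : Fin (n - 1) → ℝ} {e : Fin (n - 1) → E n} (heu : ∀ i, inner ℝ (e i) u = 0)
    (ho : (fun y => inner ℝ (x - y) u - (1 / 2) * ∑ i, κ i * inner ℝ (e i) (y - x) ^ 2)
      =o[𝓝[A] x] fun y => ‖y - x‖ ^ 2) (hw : inner ℝ w u = 0) {s : ℝ → ℝ} {C : ℝ}
    (hs : ∀ᶠ t in 𝓝[>] (0 : ℝ), 0 ≤ s t ∧ s t ≤ t ^ 2 * C ∧ x + t • w - s t • u ∈ A) :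
    Tendsto (fun t => s t / t ^ 2) (𝓝[>] 0)
      (𝓝 (1 / 2 * ∑ i, κ i * inner ℝ (e i) w ^ 2)) := by
  have huu : inner ℝ u u = (1 : ℝ) := by simp [hu]
  set y : ℝ → E n := fun t => x + t • w - s t • u with hy
  have ht0 : Tendsto (fun t : ℝ => t) (𝓝[>] 0) (𝓝 0) := tendsto_id.mono_left nhdsWithin_le_nhds
  have hs0 : Tendsto s (𝓝[>] 0) (𝓝 0) := by
    refine tendsto_of_tendsto_of_tendsto_of_le_of_le' tendsto_const_nhds
      (h := fun t => t ^ 2 * C) ?_ (hs.mono fun t h => h.1) (hs.mono fun t h => h.2.1)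
    simpa using (ht0.pow 2).mul_const C
  have hylim : Tendsto y (𝓝[>] 0) (𝓝[A] x) := by
    refine tendsto_nhdsWithin_iff.2 ⟨?_, hs.mono fun t h => h.2.2⟩
    have := (tendsto_const_nhds (x := x)).add (ht0.smul_const w) |>.sub (hs0.smul_const u)
    simpa using this
  have hnorm : (fun t => ‖y t - x‖ ^ 2) =O[𝓝[>] (0 : ℝ)] fun t => t ^ 2 := by
    refine IsBigO.pow ?_ 2
    refine IsBigO.of_bound (‖w‖ + |C|) ?_
    filter_upwards [hs, self_mem_nhdsWithin,
      nhdsWithin_le_nhds (Iio_mem_nhds (zero_lt_one (α := ℝ)))] with t h1 h2 h3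
    have ht : 0 < t := h2
    have ht1 : t < 1 := h3
    have e1 : y t - x = t • w - s t • u := by simp [hy]; abel
    rw [norm_norm, e1, Real.norm_eq_abs, abs_of_pos ht]
    refine (norm_sub_le _ _).trans ?_
    rw [norm_smul, norm_smul, hu, Real.norm_eq_abs, Real.norm_eq_abs, abs_of_pos ht,
      abs_of_nonneg h1.1]
    have e2 : t ^ 2 * C ≤ t * |C| := by
      have : C ≤ |C| := le_abs_self C
      have h0 : 0 ≤ |C| := abs_nonneg C
      nlinarith [mul_nonneg ht.le h0]
    nlinarith [h1.2.1]
  have hF := (ho.comp_tendsto hylim).trans_isBigO hnorm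
  have hF' := hF.tendsto_div_nhds_zero
  have := hF'.add_const (1 / 2 * ∑ i, κ i * inner ℝ (e i) w ^ 2)
  rw [zero_add] at this
  refine this.congr' ?_
  filter_upwards [self_mem_nhdsWithin] with t ht
  have ht : 0 < t := ht
  have e1 : y t - x = t • w - s t • u := by simp [hy]; abel
  have e2 : inner ℝ (x - y t) u = s t := by
    rw [← neg_sub, e1, inner_neg_left, inner_sub_left, real_inner_smul_left, real_inner_smul_left,
      hw, huu]; ring
  have e3 : ∀ i, inner ℝ (e i) (y t - x) = t * inner ℝ (e i) w := by
    intro i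
    rw [e1, inner_sub_right, real_inner_smul_right, real_inner_smul_right, heu]; ring
  simp only [Function.comp, e2, e3, mul_pow]
  have e4 : ∑ i, κ i * (t ^ 2 * inner ℝ (e i) w ^ 2)
      = t ^ 2 * ∑ i, κ i * inner ℝ (e i) w ^ 2 := by
    rw [Finset.mul_sum]; exact Finset.sum_congr rfl fun i _ => by ring
  rw [e4]
  field_simp
  ring

theorem exists_height_function {n : ℕ} {M : Set (E n)} (hcl : IsClosed M)
    {x u w : E n} {r : ℝ} (hr : 0 < r)
    (hu : IsOuterUnitNormal M x u) (hb : closedBall (x - r • u) r ⊆ M) (hw : inner ℝ w u = 0) :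
    ∃ s : ℝ → ℝ, ∀ᶠ t in 𝓝[>] (0 : ℝ),
      0 ≤ s t ∧ s t ≤ t ^ 2 * (‖w‖ ^ 2 / r) ∧ x + t • w - s t • u ∈ frontier M := by
  have key : ∀ᶠ t in 𝓝[>] (0 : ℝ), ∃ s : ℝ,
      0 ≤ s ∧ s ≤ t ^ 2 * (‖w‖ ^ 2 / r) ∧ x + t • w - s • u ∈ frontier M := by
    have h1 : ∀ᶠ t in 𝓝[>] (0 : ℝ), ‖t • w‖ < r := by
      have : Tendsto (fun t : ℝ => ‖t • w‖) (𝓝[>] 0) (𝓝 0) := by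
        have h : Tendsto (fun t : ℝ => ‖t • w‖) (𝓝 0) (𝓝 ‖(0 : ℝ) • w‖) :=
          Continuous.tendsto (by fun_prop) 0
        rw [zero_smul, norm_zero] at h
        exact h.mono_left nhdsWithin_le_nhds
      exact this.eventually (gt_mem_nhds hr)
    filter_upwards [h1] with t ht
    obtain ⟨s, hs0, hs1, hs⟩ := exists_frontier_over_tangent hcl hr hu hb (w := t • w)
      (by rw [real_inner_smul_left, hw, mul_zero]) ht.le
    refine ⟨s, hs0, hs1.trans_eq ?_, hs⟩
    rw [norm_smul, mul_pow, Real.norm_eq_abs, sq_abs]; ring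
  choose! s hs using fun t (h : ∃ s : ℝ, 0 ≤ s ∧ s ≤ t ^ 2 * (‖w‖ ^ 2 / r) ∧
    x + t • w - s • u ∈ frontier M) => h
  exact ⟨s, key.mono hs⟩

theorem HasSecondOrderExpansion.unique {n : ℕ} (hn : 1 ≤ n) {M : Set (E n)} (hcl : IsClosed M)
    {x u : E n} {r : ℝ} (hr : 0 < r)
    (hu : IsOuterUnitNormal M x u) (hb : closedBall (x - r • u) r ⊆ M) {κ κ' : Fin (n - 1) → ℝ}
    (h : HasSecondOrderExpansion (frontier M) x u κ)
    (h' : HasSecondOrderExpansion (frontier M) x u κ') : κ = κ' := by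
  obtain ⟨hκ, e, he, heu, ho⟩ := h
  obtain ⟨hκ', e', he', heu', ho'⟩ := h'
  have hQ : ∀ w, inner ℝ w u = 0 →
      ∑ i, κ i * inner ℝ (e i) w ^ 2 = ∑ i, κ' i * inner ℝ (e' i) w ^ 2 := by
    intro w hw
    obtain ⟨s, hs⟩ := exists_height_function hcl hr hu hb hw
    have := tendsto_nhds_unique (tendsto_height_div_sq hu.1 heu ho hw hs)
      (tendsto_height_div_sq hu.1 heu' ho' hw hs)
    linarith
  funext i
  exact le_antisymm
    (principal_values_le hn hu.1 he' heu' he heu hκ' hκ (fun w hw => (hQ w hw).symm) i)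
    (principal_values_le hn hu.1 he heu he' heu' hκ hκ' hQ i)

theorem HasSecondOrderExpansion.mem_Icc {n : ℕ} {M : Set (E n)} (hcl : IsClosed M)
    {x u : E n} {r : ℝ} (hr : 0 < r)
    (hu : IsOuterUnitNormal M x u) (hb : closedBall (x - r • u) r ⊆ M) {κ : Fin (n - 1) → ℝ}
    (h : HasSecondOrderExpansion (frontier M) x u κ) : κ ∈ Icc 0 (fun _ => 2 / r) := by
  obtain ⟨hκ, e, he, heu, ho⟩ := h
  have key : ∀ i, 0 ≤ κ i ∧ κ i ≤ 2 / r := by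
    intro i
    obtain ⟨s, hs⟩ := exists_height_function hcl hr hu hb (heu i)
    have hlim := tendsto_height_div_sq hu.1 heu ho (heu i) hs
    have hQ : ∑ j, κ j * inner ℝ (e j) (e i) ^ 2 = κ i := by
      rw [Finset.sum_eq_single i]
      · simp [he.1 i]
      · intro j _ hj
        rw [he.2 hj]; simp
      · simp
    rw [hQ] at hlim
    rw [he.1 i] at hs
    have h1 := ge_of_tendsto hlim (b := 0) (by
      filter_upwards [hs] with t ht
      exact div_nonneg ht.1 (sq_nonneg _))
    -- The depth is at most `t² / r` and the limit is `κ i / 2`, whence the crude bound `2 / r`.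
    have h2 := le_of_tendsto hlim (b := 1 / r) (by
      filter_upwards [hs, self_mem_nhdsWithin] with t ht h0
      have : 0 < t := h0
      rw [div_le_iff₀ (by positivity)]
      have := ht.2.1
      rw [one_pow] at this
      linarith)
    refine ⟨by linarith, ?_⟩
    have : 2 / r = 2 * (1 / r) := by ring
    linarith
  exact ⟨fun i => (key i).1, fun i => (key i).2⟩

/-! ### Values of the normal and curvature functions -/

-- Equivalent predicates are equal, so choice picks the same witness; agreement of two bodies then
-- needs no uniqueness.
open Classical in
theorem dite_choose_congr {α : Type*} {d : α} {P Q : α → Prop} (h : P = Q) :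
    (if h : ∃ a, P a then h.choose else d) = if h : ∃ a, Q a then h.choose else d := by
  subst h; rfl

theorem outerNormal_congr {n : ℕ} {K M : Set (E n)} {x : E n}
    (h : ∀ u, IsOuterUnitNormal K x u ↔ IsOuterUnitNormal M x u) :
    outerNormal K x = outerNormal M x := by
  exact dite_choose_congr (funext fun u => propext (h u))

theorem principalCurvature_congr {n : ℕ} {K M : Set (E n)} {x : E n}
    (h : ∀ κ, IsPrincipalCurvatures K x κ ↔ IsPrincipalCurvatures M x κ) :
    principalCurvature K x = principalCurvature M x := by
  exact dite_choose_congr (funext fun κ => propext (h κ))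

theorem isPrincipalCurvatures_iff {n : ℕ} {K : Set (E n)} {x : E n} {κ : Fin (n - 1) → ℝ} :
    IsPrincipalCurvatures K x κ ↔
      HasSecondOrderExpansion (frontier K) x (outerNormal K x) κ := Iff.rfl

theorem principalCurvature_eq {n : ℕ} (hn : 1 ≤ n) {K : Set (E n)} (hc : Convex ℝ K)
    (hcl : IsClosed K) {x : E n} (hx : x ∈ frontier K) {r : ℝ} (hr : 0 < r)
    (hb : closedBall (x - r • outerNormal K x) r ⊆ K) {κ : Fin (n - 1) → ℝ}
    (h : IsPrincipalCurvatures K x κ) : principalCurvature K x = κ := by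
  have hex : ∃ κ, IsPrincipalCurvatures K x κ := ⟨κ, h⟩
  rw [principalCurvature, dif_pos hex]
  exact HasSecondOrderExpansion.unique hn hcl hr (outerNormal_spec hc hcl hx) hb
    hex.choose_spec h

theorem principalCurvature_mem_Icc {n : ℕ} {K : Set (E n)} (hc : Convex ℝ K)
    (hcl : IsClosed K) {x : E n} (hx : x ∈ frontier K) {r : ℝ} (hr : 0 < r)
    (hb : closedBall (x - r • outerNormal K x) r ⊆ K) :
    principalCurvature K x ∈ Icc 0 (fun _ => 2 / r) := by
  by_cases hex : ∃ κ, IsPrincipalCurvatures K x κ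
  · rw [principalCurvature, dif_pos hex]
    exact HasSecondOrderExpansion.mem_Icc hcl hr (outerNormal_spec hc hcl hx) hb hex.choose_spec
  · rw [principalCurvature, dif_neg hex]
    exact ⟨le_rfl, fun i => by positivity⟩

/-! ### Measurability of the principal curvatures -/

/-- The deviation of the height of `y` below the tangent plane at `x` from a quadratic form. -/
noncomputable def heightDefect {n : ℕ} (x u : E n) (κ : Fin (n - 1) → ℝ) (e : Fin (n - 1) → E n)
    (y : E n) : ℝ :=
  inner ℝ (x - y) u - (1 / 2) * ∑ i, κ i * inner ℝ (e i) (y - x) ^ 2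

/-- Points of `frontier K` with a normal, candidate curvatures in `G` and principal directions, for
which the second order expansion holds within distance `δ` up to an error `η`. -/
def approxCurvatureData {n : ℕ} (K : Set (E n)) (B δ η : ℝ) (G : Set (Fin (n - 1) → ℝ)) :
    Set (E n × E n × (Fin (n - 1) → ℝ) × (Fin (n - 1) → E n)) :=
  {q | q.1 ∈ frontier K ∧ IsOuterUnitNormal K q.1 q.2.1 ∧ q.2.2.1 ∈ Icc 0 (fun _ => B) ∧
    q.2.2.1 ∈ G ∧ Monotone q.2.2.1 ∧ Orthonormal ℝ q.2.2.2 ∧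
    (∀ i, inner ℝ (q.2.2.2 i) q.2.1 = 0) ∧
    ∀ y ∈ frontier K, ‖y - q.1‖ < δ →
      |heightDefect q.1 q.2.1 q.2.2.1 q.2.2.2 y| ≤ η * ‖y - q.1‖ ^ 2}

theorem isCompact_approxCurvatureData {n : ℕ} {K : Set (E n)} (hK : IsCompact K) (B δ η : ℝ)
    {G : Set (Fin (n - 1) → ℝ)} (hG : IsClosed G) :
    IsCompact (approxCurvatureData K B δ η G) := by
  have hcpt : IsCompact (frontier K ×ˢ sphere (0 : E n) 1 ×ˢ
      Icc (0 : Fin (n - 1) → ℝ) (fun _ => B) ×ˢ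
      Set.pi univ fun _ : Fin (n - 1) => sphere (0 : E n) 1) :=
    (hK.of_isClosed_subset isClosed_frontier hK.isClosed.frontier_subset).prod
      ((isCompact_sphere _ _).prod (isCompact_Icc.prod
        (isCompact_univ_pi fun _ => isCompact_sphere _ _)))
  refine hcpt.of_isClosed_subset ?_ ?_
  · refine (isClosed_frontier.preimage continuous_fst).inter (IsClosed.inter ?_ (IsClosed.inter ?_
      (IsClosed.inter ?_ (IsClosed.inter ?_ (IsClosed.inter ?_ (IsClosed.inter ?_ ?_))))))
    · exact (isClosed_setOf_isOuterUnitNormal K).preimage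
        (continuous_fst.prodMk (continuous_fst.comp continuous_snd))
    · exact isClosed_Icc.preimage (by fun_prop)
    · exact hG.preimage (by fun_prop)
    · have : {q : E n × E n × (Fin (n - 1) → ℝ) × (Fin (n - 1) → E n) | Monotone q.2.2.1} =
          ⋂ i, ⋂ j, ⋂ _ : i ≤ j, {q | q.2.2.1 i ≤ q.2.2.1 j} := by
        ext q; simp [Monotone]
      change IsClosed {q : E n × E n × (Fin (n - 1) → ℝ) × (Fin (n - 1) → E n) | Monotone q.2.2.1}
      rw [this]
      exact isClosed_iInter fun i => isClosed_iInter fun j => isClosed_iInter fun _ =>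
        isClosed_le (by fun_prop) (by fun_prop)
    · have : {q : E n × E n × (Fin (n - 1) → ℝ) × (Fin (n - 1) → E n) | Orthonormal ℝ q.2.2.2} =
          ⋂ i, ⋂ j, {q | inner ℝ (q.2.2.2 i) (q.2.2.2 j) = if i = j then (1 : ℝ) else 0} := by
        ext q; simp [orthonormal_iff_ite]
      change IsClosed {q : E n × E n × (Fin (n - 1) → ℝ) × (Fin (n - 1) → E n) |
        Orthonormal ℝ q.2.2.2}
      rw [this]
      exact isClosed_iInter fun i => isClosed_iInter fun j =>
        isClosed_eq (by fun_prop) (by fun_prop)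
    · have : {q : E n × E n × (Fin (n - 1) → ℝ) × (Fin (n - 1) → E n) |
          ∀ i, inner ℝ (q.2.2.2 i) q.2.1 = (0 : ℝ)} =
          ⋂ i, {q | inner ℝ (q.2.2.2 i) q.2.1 = (0 : ℝ)} := by
        ext q; simp
      change IsClosed {q : E n × E n × (Fin (n - 1) → ℝ) × (Fin (n - 1) → E n) |
        ∀ i, inner ℝ (q.2.2.2 i) q.2.1 = (0 : ℝ)}
      rw [this]
      exact isClosed_iInter fun i => isClosed_eq (by fun_prop) (by fun_prop)
    -- For fixed `y` the strict hypothesis turns the implication into a union of two closed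
    -- conditions.
    · have : {q : E n × E n × (Fin (n - 1) → ℝ) × (Fin (n - 1) → E n) |
          ∀ y ∈ frontier K, ‖y - q.1‖ < δ →
            |heightDefect q.1 q.2.1 q.2.2.1 q.2.2.2 y| ≤ η * ‖y - q.1‖ ^ 2} =
          ⋂ y ∈ frontier K, ({q | δ ≤ ‖y - q.1‖} ∪
            {q | |heightDefect q.1 q.2.1 q.2.2.1 q.2.2.2 y| ≤ η * ‖y - q.1‖ ^ 2}) := by
        ext q
        simp only [mem_ofPred_eq, mem_iInter, mem_union]
        refine forall₂_congr fun y _ => ?_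
        exact ⟨fun h => (le_or_gt δ _).imp id h, fun h h' => h.resolve_left h'.not_ge⟩
      change IsClosed {q : E n × E n × (Fin (n - 1) → ℝ) × (Fin (n - 1) → E n) |
          ∀ y ∈ frontier K, ‖y - q.1‖ < δ →
            |heightDefect q.1 q.2.1 q.2.2.1 q.2.2.2 y| ≤ η * ‖y - q.1‖ ^ 2}
      rw [this]
      refine isClosed_iInter fun y => isClosed_iInter fun _ => IsClosed.union
        (isClosed_le (by fun_prop) (by fun_prop)) (isClosed_le ?_ (by fun_prop))
      unfold heightDefect
      fun_prop
  · rintro ⟨x, u, κ, e⟩ ⟨h1, h2, h3, -, -, h4, -⟩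
    refine ⟨h1, ?_, h3, fun i _ => ?_⟩
    · simpa using h2.1
    · simpa using h4.1 i

theorem abs_heightDefect_sub_le {n : ℕ} (x u y : E n) {κ κ' : Fin (n - 1) → ℝ}
    {e e' : Fin (n - 1) → E n} (he : ∀ i, ‖e i‖ = 1) (he' : ∀ i, ‖e' i‖ = 1) :
    |heightDefect x u κ e y - heightDefect x u κ' e' y| ≤
      (∑ i, (|κ i - κ' i| + 2 * |κ i| * ‖e i - e' i‖)) * ‖y - x‖ ^ 2 := by
  have h1 : heightDefect x u κ e y - heightDefect x u κ' e' y = (1 / 2) *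
      ∑ i, (κ' i * inner ℝ (e' i) (y - x) ^ 2 - κ i * inner ℝ (e i) (y - x) ^ 2) := by
    rw [heightDefect, heightDefect, Finset.sum_sub_distrib]; ring
  have h2 : |∑ i, (κ' i * inner ℝ (e' i) (y - x) ^ 2 - κ i * inner ℝ (e i) (y - x) ^ 2)| ≤
      (∑ i, (|κ i - κ' i| + 2 * |κ i| * ‖e i - e' i‖)) * ‖y - x‖ ^ 2 := by
    rw [Finset.sum_mul]
    refine (Finset.abs_sum_le_sum_abs _ _).trans (Finset.sum_le_sum fun i _ => ?_)
    set v := y - x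
    have ha : |inner ℝ (e i) v| ≤ ‖v‖ := by
      simpa [he i] using abs_real_inner_le_norm (e i) v
    have hb : |inner ℝ (e' i) v| ≤ ‖v‖ := by
      simpa [he' i] using abs_real_inner_le_norm (e' i) v
    have hab : |inner ℝ (e i) v - inner ℝ (e' i) v| ≤ ‖e i - e' i‖ * ‖v‖ := by
      rw [← inner_sub_left]; exact abs_real_inner_le_norm _ _
    set a := inner ℝ (e i) v
    set b := inner ℝ (e' i) v
    have e1 : κ' i * b ^ 2 - κ i * a ^ 2
        = -((κ i - κ' i) * (b * b) + κ i * ((a - b) * (a + b))) := by ring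
    rw [e1, abs_neg]
    refine (abs_add_le _ _).trans ?_
    rw [abs_mul, abs_mul, abs_mul, abs_mul, add_mul]
    refine add_le_add ?_ ?_
    · refine mul_le_mul_of_nonneg_left ?_ (abs_nonneg _)
      rw [sq]; exact mul_le_mul hb hb (abs_nonneg _) (norm_nonneg _)
    · have h3 : |a + b| ≤ 2 * ‖v‖ := (abs_add_le _ _).trans (by linarith)
      calc |κ i| * (|a - b| * |a + b|) ≤ |κ i| * ((‖e i - e' i‖ * ‖v‖) * (2 * ‖v‖)) := by gcongr
        _ = _ := by ring
  rw [h1, abs_mul, abs_of_pos (by norm_num : (0 : ℝ) < 1 / 2)]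
  have := abs_nonneg (∑ i, (κ' i * inner ℝ (e' i) (y - x) ^ 2 - κ i * inner ℝ (e i) (y - x) ^ 2))
  linarith

/-- On the right the curvatures and directions may vary with the error `1/(m+1)`. By compactness
they subconverge, and `abs_heightDefect_sub_le` shows that the limit satisfies the expansion; `G`
closed keeps the limit in `G`. -/
theorem setOf_exists_isPrincipalCurvatures_mem_eq {n : ℕ} {K : Set (E n)} (hK : IsCompact K)
    (hc : Convex ℝ K) {r : ℝ} (hr : 0 < r)
    (hb : ∀ x ∈ frontier K, closedBall (x - r • outerNormal K x) r ⊆ K)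
    {G : Set (Fin (n - 1) → ℝ)} (hG : IsClosed G) :
    {x | x ∈ frontier K ∧ ∃ κ, IsPrincipalCurvatures K x κ ∧ κ ∈ G} =
      ⋂ m : ℕ, ⋃ k : ℕ, Prod.fst ''
        approxCurvatureData K (2 / r) (1 / ((k : ℝ) + 1)) (1 / ((m : ℝ) + 1)) G := by
  ext x
  simp only [mem_ofPred_eq, mem_iInter, mem_iUnion]
  constructor
  · rintro ⟨hx, κ, hκ, hκG⟩ m
    have hu := outerNormal_spec hc hK.isClosed hx
    have hbox := HasSecondOrderExpansion.mem_Icc hK.isClosed hr hu (hb x hx) hκ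
    obtain ⟨hmono, e, he, heu, ho⟩ := hκ
    have h1 := (isLittleO_iff.1 ho) (c := 1 / ((m : ℝ) + 1)) (by positivity)
    rw [Filter.Eventually, Metric.mem_nhdsWithin_iff] at h1
    obtain ⟨ε, hε, h1⟩ := h1
    obtain ⟨k, hk⟩ := exists_nat_one_div_lt hε
    refine ⟨k, ⟨x, outerNormal K x, κ, e⟩, ⟨hx, hu, hbox, hκG, hmono, he, heu, ?_⟩, rfl⟩
    intro y hy hyx
    have := h1 ⟨by rw [mem_ball, dist_eq_norm]; exact hyx.trans hk, hy⟩
    simpa [heightDefect] using this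
  · intro h
    choose k q hq hqx using h
    have hx : x ∈ frontier K := hqx 0 ▸ (hq 0).1
    have hu := outerNormal_spec hc hK.isClosed hx
    have hqu : ∀ m, (q m).2.1 = outerNormal K x := by
      intro m
      have := (hq m).2.1
      rw [hqx m] at this
      exact hu.eq_of_ball hr (hb x hx) (hK.isClosed.frontier_subset hx) this
    have hcpt : IsCompact (Icc (0 : Fin (n - 1) → ℝ) (fun _ => 2 / r) ×ˢ
        Set.pi univ fun _ : Fin (n - 1) => sphere (0 : E n) 1) :=
      isCompact_Icc.prod (isCompact_univ_pi fun _ => isCompact_sphere _ _)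
    obtain ⟨⟨κ, e⟩, -, φ, hφ, hlim⟩ := hcpt.tendsto_subseq (x := fun m => (q m).2.2) (fun m =>
      ⟨(hq m).2.2.1, fun i _ => by simpa using (hq m).2.2.2.2.2.1.1 i⟩)
    have hdata : ∀ m, ((x, outerNormal K x, (q m).2.2) :
        E n × E n × (Fin (n - 1) → ℝ) × (Fin (n - 1) → E n)) ∈
          approxCurvatureData K (2 / r) (1 / ((k m : ℝ) + 1)) (1 / ((m : ℝ) + 1)) G := by
      intro m
      have : ((x, outerNormal K x, (q m).2.2) :
        E n × E n × (Fin (n - 1) → ℝ) × (Fin (n - 1) → E n)) = q m := by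
        rw [← hqu m, ← hqx m]
      rw [this]; exact hq m
    -- With `δ = 0` the expansion condition is vacuous, leaving only the closed conditions that pass
    -- to the limit.
    have hweak : ∀ m, ((x, outerNormal K x, (q m).2.2) :
        E n × E n × (Fin (n - 1) → ℝ) × (Fin (n - 1) → E n)) ∈
          approxCurvatureData K (2 / r) 0 0 G := by
      intro m
      obtain ⟨h1, h2, h3, h4, h5, h6, h7, -⟩ := hdata m
      exact ⟨h1, h2, h3, h4, h5, h6, h7, fun y _ hy => absurd hy (norm_nonneg _).not_gt⟩
    have hlimdata : ((x, outerNormal K x, κ, e) :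
        E n × E n × (Fin (n - 1) → ℝ) × (Fin (n - 1) → E n)) ∈
          approxCurvatureData K (2 / r) 0 0 G := by
      refine (isCompact_approxCurvatureData hK _ _ _ hG).isClosed.mem_of_tendsto
        (tendsto_const_nhds.prodMk_nhds (tendsto_const_nhds.prodMk_nhds hlim))
        (Eventually.of_forall fun m => hweak (φ m))
    obtain ⟨-, -, -, hκG, hmono, he, heu, -⟩ := hlimdata
    refine ⟨hx, κ, ⟨hmono, e, he, heu, ?_⟩, hκG⟩
    refine isLittleO_iff.2 fun c hc0 => ?_
    have hη : Tendsto (fun m => ∑ i, (|κ i - (q (φ m)).2.2.1 i| +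
        2 * |κ i| * ‖e i - (q (φ m)).2.2.2 i‖)) atTop (𝓝 0) := by
      have hcont : Continuous fun z : (Fin (n - 1) → ℝ) × (Fin (n - 1) → E n) =>
          ∑ i, (|κ i - z.1 i| + 2 * |κ i| * ‖e i - z.2 i‖) := by fun_prop
      have := (hcont.tendsto (κ, e)).comp hlim
      simpa [Function.comp_def] using this
    have h1 : ∀ᶠ m in atTop, 1 / ((φ m : ℝ) + 1) < c / 2 :=
      (tendsto_one_div_add_atTop_nhds_zero_nat.comp hφ.tendsto_atTop).eventually
        (gt_mem_nhds (by positivity))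
    obtain ⟨m, hm1, hm2⟩ := (h1.and (hη.eventually (gt_mem_nhds (half_pos hc0)))).exists
    rw [Filter.Eventually, Metric.mem_nhdsWithin_iff]
    refine ⟨1 / ((k (φ m) : ℝ) + 1), by positivity, ?_⟩
    rintro y ⟨hyx, hy⟩
    rw [mem_ball, dist_eq_norm] at hyx
    have h2 := (hdata (φ m)).2.2.2.2.2.2.2 y hy hyx
    have h3 := abs_heightDefect_sub_le x (outerNormal K x) y (κ := κ) (κ' := (q (φ m)).2.2.1)
      he.1 (hdata (φ m)).2.2.2.2.2.1.1
    change ‖heightDefect x (outerNormal K x) κ e y‖ ≤ c * ‖‖y - x‖ ^ 2‖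
    rw [Real.norm_eq_abs, Real.norm_eq_abs, abs_of_nonneg (sq_nonneg ‖y - x‖)]
    have h4 := abs_sub_abs_le_abs_sub (heightDefect x (outerNormal K x) κ e y)
      (heightDefect x (outerNormal K x) (q (φ m)).2.2.1 (q (φ m)).2.2.2 y)
    have h5 := mul_le_mul_of_nonneg_right hm1.le (sq_nonneg ‖y - x‖)
    have h6 := mul_le_mul_of_nonneg_right hm2.le (sq_nonneg ‖y - x‖)
    simp only at h2
    linarith

theorem measurable_indicator_principalCurvature {n : ℕ} (hn : 1 ≤ n) {K : Set (E n)}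
    (hK : IsCompact K) (hc : Convex ℝ K) {r : ℝ} (hr : 0 < r)
    (hb : ∀ x ∈ frontier K, closedBall (x - r • outerNormal K x) r ⊆ K) :
    Measurable ((frontier K).indicator (principalCurvature K)) := by
  have hS : ∀ G : Set (Fin (n - 1) → ℝ), IsClosed G →
      MeasurableSet {x | x ∈ frontier K ∧ ∃ κ, IsPrincipalCurvatures K x κ ∧ κ ∈ G} := by
    intro G hG
    rw [setOf_exists_isPrincipalCurvatures_mem_eq hK hc hr hb hG]
    exact MeasurableSet.iInter fun m => MeasurableSet.iUnion fun k =>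
      ((isCompact_approxCurvatureData hK _ _ _ hG).image continuous_fst).isClosed.measurableSet
  have hpc : ∀ x ∈ frontier K, ∀ κ, IsPrincipalCurvatures K x κ → principalCurvature K x = κ :=
    fun x hx κ h => principalCurvature_eq hn hc hK.isClosed hx hr (hb x hx) h
  have hpc0 : ∀ x, (¬ ∃ κ, IsPrincipalCurvatures K x κ) → principalCurvature K x = 0 :=
    fun x h => by rw [principalCurvature, dif_neg h]
  refine measurable_of_isClosed fun G hG => ?_
  -- The second set collects the points where the value is `0` by default: off the boundary, or
  -- without curvatures.
  have hset : (frontier K).indicator (principalCurvature K) ⁻¹' G =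
      {x | x ∈ frontier K ∧ ∃ κ, IsPrincipalCurvatures K x κ ∧ κ ∈ G} ∪
      ({x | x ∈ frontier K ∧ ∃ κ, IsPrincipalCurvatures K x κ ∧ κ ∈ univ}ᶜ ∩
        {_x | (0 : Fin (n - 1) → ℝ) ∈ G}) := by
    ext x
    simp only [mem_preimage, mem_union, mem_inter_iff, mem_compl_iff, mem_ofPred_eq, mem_univ,
      and_true]
    by_cases hx : x ∈ frontier K
    · rw [indicator_of_mem hx]
      by_cases hex : ∃ κ, IsPrincipalCurvatures K x κ
      · obtain ⟨κ, hκ⟩ := hex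
        rw [hpc x hx κ hκ]
        constructor
        · exact fun h => Or.inl ⟨hx, κ, hκ, h⟩
        · rintro (⟨-, κ', hκ', h⟩ | ⟨h, -⟩)
          · rwa [← hpc x hx κ hκ, hpc x hx κ' hκ']
          · exact absurd ⟨hx, κ, hκ⟩ h
      · rw [hpc0 x hex]
        constructor
        · exact fun h => Or.inr ⟨fun h' => hex h'.2, h⟩
        · rintro (⟨-, κ', hκ', h⟩ | ⟨-, h⟩)
          · exact absurd ⟨κ', hκ'⟩ hex
          · exact h
    · rw [indicator_of_notMem hx]
      simp [hx]
  rw [hset]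
  exact (hS G hG).union ((hS univ isClosed_univ).compl.inter (MeasurableSet.const _))

/-! ### Lipschitz charts and finiteness of the boundary measure -/

/-- `π` is injective on `S` with `C`-Lipschitz inverse, and both measures carry the same normalizing
constant. `S` may be non-measurable. -/
theorem euclideanHausdorffMeasure_le_image {X Y : Type*} [MetricSpace X] [MeasurableSpace X]
    [BorelSpace X] [MetricSpace Y] [MeasurableSpace Y] [BorelSpace Y] (d : ℕ) {π : X → Y}
    {S : Set X} {C : NNReal} (h : ∀ y ∈ S, ∀ a ∈ S, dist y a ≤ C * dist (π y) (π a)) :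
    (μHE[d] : Measure X) S ≤ (C : ENNReal) ^ d * (μHE[d] : Measure Y) (π '' S) := by
  rcases S.eq_empty_or_nonempty with rfl | ⟨x₀, hx₀⟩
  · simp
  have : Nonempty X := ⟨x₀⟩
  have hinj : InjOn π S := fun y hy a ha hya => by
    have := h y hy a ha
    rw [hya, dist_self, mul_zero] at this
    exact dist_le_zero.1 this
  have hg : ∀ y ∈ S, Function.invFunOn π S (π y) = y := fun y hy => hinj.leftInvOn_invFunOn hy
  have hlip : LipschitzOnWith C (Function.invFunOn π S) (π '' S) := by
    refine LipschitzOnWith.of_dist_le_mul ?_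
    rintro _ ⟨y, hy, rfl⟩ _ ⟨a, ha, rfl⟩
    rw [hg y hy, hg a ha]
    exact h y hy a ha
  have himg : Function.invFunOn π S '' (π '' S) = S := by
    rw [image_image]
    exact (image_congr hg).trans (image_id S)
  have := hlip.hausdorffMeasure_image_le (d := d) (Nat.cast_nonneg d)
  rw [himg] at this
  simp only [Measure.euclideanHausdorffMeasure_def, Measure.smul_apply]
  rw [ENNReal.smul_def, ENNReal.smul_def, smul_eq_mul, smul_eq_mul, mul_left_comm]
  gcongr
  simpa using this

theorem exists_tangential_coordinates {n : ℕ} (hn : 1 ≤ n) {u : E n} (hu : ‖u‖ = 1) :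
    ∃ π : E n → EuclideanSpace ℝ (Fin (n - 1)), ∀ y a,
      ‖y - a‖ ^ 2 = ‖π y - π a‖ ^ 2 + inner ℝ (y - a) u ^ 2 := by
  obtain ⟨b, hb⟩ := exists_orthonormalBasis_option hn hu
  refine ⟨fun y => WithLp.toLp 2 fun i => inner ℝ (b (some i)) y, fun y a => ?_⟩
  rw [← b.sum_sq_norm_inner_right (y - a), Fintype.sum_option, hb, EuclideanSpace.norm_sq_eq,
    real_inner_comm]
  simp [inner_sub_right, add_comm]

/-- Near a boundary point with an inner touching ball the boundary projects bijectively, with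
Lipschitz inverse, into the tangent hyperplane. -/
theorem exists_local_chart {n : ℕ} (hn : 1 ≤ n) {M : Set (E n)} (hc : Convex ℝ M)
    (hcl : IsClosed M) {x u : E n} {r : ℝ} (hr : 0 < r) (hu : IsOuterUnitNormal M x u)
    (hb : closedBall (x - r • u) r ⊆ M) :
    ∃ π : E n → EuclideanSpace ℝ (Fin (n - 1)), (∀ y a, dist (π y) (π a) ≤ dist y a) ∧
      ∀ y ∈ frontier M ∩ ball x (r / 8), ∀ a ∈ frontier M ∩ ball x (r / 8),
        dist y a ≤ (2 : NNReal) * dist (π y) (π a) := by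
  obtain ⟨π, hπ⟩ := exists_tangential_coordinates hn hu.1
  refine ⟨π, fun y a => ?_, fun y hy a ha => ?_⟩
  · rw [dist_eq_norm, dist_eq_norm]
    refine abs_le_of_sq_le_sq' ?_ (norm_nonneg _) |>.2
    rw [hπ]; linarith [sq_nonneg (inner ℝ (y - a) u)]
  · have h1 := abs_inner_sub_le hc hcl hr hu hb hy.1 ha.1
    have hy' := hy.2
    have ha' := ha.2
    rw [mem_ball, dist_eq_norm] at hy' ha'
    -- Radius `r / 8` makes the normal component of `y - a` at most half its length, so the
    -- tangential part dominates.
    have h2 : ‖y - a‖ * (‖y - x‖ + ‖a - x‖) ≤ ‖y - a‖ * (r / 4) :=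
      mul_le_mul_of_nonneg_left (by linarith) (norm_nonneg _)
    have h3 : |inner ℝ (y - a) u| ≤ ‖y - a‖ / 2 := by
      refine le_of_mul_le_mul_left ?_ hr
      linarith
    have h4 : inner ℝ (y - a) u ^ 2 ≤ (‖y - a‖ / 2) ^ 2 := by
      rw [← sq_abs]; gcongr
    rw [dist_eq_norm, dist_eq_norm]
    refine abs_le_of_sq_le_sq' ?_ (by positivity) |>.2
    have := hπ y a
    rw [NNReal.coe_ofNat, mul_pow]
    nlinarith

theorem euclideanHausdorffMeasure_frontier_lt_top {n : ℕ} (hn : 1 ≤ n) {M : Set (E n)}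
    (hM : IsCompact M) (hc : Convex ℝ M) {r : ℝ} (hr : 0 < r)
    (hb : ∀ x ∈ frontier M, closedBall (x - r • outerNormal M x) r ⊆ M) :
    (μHE[n - 1] : Measure (E n)) (frontier M) < ⊤ := by
  refine (hM.of_isClosed_subset isClosed_frontier hM.isClosed.frontier_subset
    ).measure_lt_top_of_nhdsWithin fun x hx => ?_
  obtain ⟨π, hπ1, hπ2⟩ := exists_local_chart hn hc hM.isClosed hr
    (outerNormal_spec hc hM.isClosed hx) (hb x hx)
  refine ⟨frontier M ∩ ball x (r / 8),
    inter_mem self_mem_nhdsWithin (nhdsWithin_le_nhds (ball_mem_nhds x (by positivity))), ?_⟩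
  refine (euclideanHausdorffMeasure_le_image (n - 1) hπ2).trans_lt ?_
  rw [EuclideanSpace.euclideanHausdorffMeasure_eq_volume]
  refine ENNReal.mul_lt_top (by simp) ?_
  refine (measure_mono (t := ball (π x) (r / 8)) ?_).trans_lt measure_ball_lt_top
  rintro _ ⟨y, hy, rfl⟩
  exact (hπ1 y x).trans_lt hy.2

/-! ### Density points -/

/-- Lebesgue density for the off-centre balls of radius `ε * dist w z` about `w`: the density of `S`
in them tends to `1`, so they eventually meet `S`. -/
theorem ae_exists_dist_le_of_volume {d : ℕ} (S : Set (EuclideanSpace ℝ (Fin d))) :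
    ∀ᵐ z ∂(volume.restrict S), z ∈ S → ∀ ε > 0, ∀ᶠ w in 𝓝 z, ∃ a ∈ S, dist w a ≤ ε * dist w z := by
  have h : ∀ᵐ z ∂(volume.restrict S), ∀ k : ℕ,
      Tendsto (fun w => volume (S ∩ closedBall w (1 / ((k : ℝ) + 1) * dist w z)) /
        volume (closedBall w (1 / ((k : ℝ) + 1) * dist w z))) (𝓝[≠] z) (𝓝 1) := by
    refine ae_all_iff.2 fun k => ?_
    have hk : (0 : ℝ) < (k : ℝ) + 1 := by positivity
    filter_upwards [IsUnifLocDoublingMeasure.ae_tendsto_measure_inter_div volume S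
      ((k : ℝ) + 1)] with z hz
    refine hz (fun w => w) _ (tendsto_nhdsWithin_iff.2 ⟨?_, ?_⟩) (Eventually.of_forall fun w => ?_)
    · have : Tendsto (fun w => 1 / ((k : ℝ) + 1) * dist w z) (𝓝 z)
          (𝓝 (1 / ((k : ℝ) + 1) * dist z z)) := Continuous.tendsto (by fun_prop) z
      rw [dist_self, mul_zero] at this
      exact this.mono_left nhdsWithin_le_nhds
    · filter_upwards [self_mem_nhdsWithin] with w hw
      exact mul_pos (by positivity) (dist_pos.2 hw)
    · rw [mem_closedBall, dist_comm, ← mul_assoc, mul_one_div_cancel hk.ne', one_mul]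
  filter_upwards [h] with z hz hzS ε hε
  obtain ⟨k, hk⟩ := exists_nat_one_div_lt hε
  have h1 := (hz k).eventually (lt_mem_nhds zero_lt_one)
  rw [eventually_nhdsWithin_iff] at h1
  filter_upwards [h1] with w hw
  by_cases hwz : w = z
  · exact ⟨z, hzS, by simp [hwz]⟩
  · have h2 := hw hwz
    have h3 : volume (S ∩ closedBall w (1 / ((k : ℝ) + 1) * dist w z)) ≠ 0 := by
      intro h0; rw [h0, ENNReal.zero_div] at h2; exact lt_irrefl _ h2
    obtain ⟨a, haS, ha⟩ := nonempty_of_measure_ne_zero h3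
    rw [mem_closedBall, dist_comm] at ha
    exact ⟨a, haS, ha.trans (mul_le_mul_of_nonneg_right hk.le dist_nonneg)⟩

/-- `A` is dense in `F` to first order at `x`. -/
def FirstOrderDense {n : ℕ} (A F : Set (E n)) (x : E n) : Prop :=
  ∀ ε > 0, ∀ᶠ y in 𝓝[F] x, ∃ a ∈ A, ‖y - a‖ ≤ ε * ‖y - x‖

theorem ae_firstOrderDense {n : ℕ} (hn : 1 ≤ n) {M : Set (E n)} (hc : Convex ℝ M)
    (hcl : IsClosed M) {r : ℝ} (hr : 0 < r)
    (hb : ∀ x ∈ frontier M, closedBall (x - r • outerNormal M x) r ⊆ M) {A : Set (E n)}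
    (hA : A ⊆ frontier M) :
    (μHE[n - 1] : Measure (E n)) {x | x ∈ A ∧ ¬ FirstOrderDense A (frontier M) x} = 0 := by
  refine measure_null_of_locally_null _ fun x₀ hx₀ => ?_
  have hx₀M := hA hx₀.1
  obtain ⟨π, hπ1, hπ2⟩ := exists_local_chart hn hc hcl hr (outerNormal_spec hc hcl hx₀M)
    (hb x₀ hx₀M)
  set B := ball x₀ (r / 8) with hB
  have hBo : IsOpen B := isOpen_ball
  set S := π '' (A ∩ B) with hS
  set bad := {z | ¬ ∀ ε > 0, ∀ᶠ w in 𝓝 z, ∃ a ∈ S, dist w a ≤ ε * dist w z} with hbad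
  have h0 : volume (S ∩ bad) = 0 := by
    have := ae_exists_dist_le_of_volume S
    rw [ae_iff] at this
    refine le_antisymm ((measure_mono ?_).trans
      ((Measure.le_restrict_apply _ _).trans this.le)) bot_le
    exact fun z hz => ⟨fun h => hz.2 (h hz.1), hz.1⟩
  refine ⟨{x | x ∈ A ∧ ¬ FirstOrderDense A (frontier M) x} ∩ B,
    inter_mem self_mem_nhdsWithin (nhdsWithin_le_nhds (ball_mem_nhds x₀ (by positivity))), ?_⟩
  refine le_antisymm ((euclideanHausdorffMeasure_le_image (n - 1) (fun y hy a ha =>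
    hπ2 y ⟨hA hy.1.1, hy.2⟩ a ⟨hA ha.1.1, ha.2⟩)).trans ?_) bot_le
  rw [EuclideanSpace.euclideanHausdorffMeasure_eq_volume]
  suffices h : π '' ({x | x ∈ A ∧ ¬ FirstOrderDense A (frontier M) x} ∩ B) ⊆ S ∩ bad by
    rw [measure_mono_null h h0, mul_zero]
  rintro _ ⟨x, ⟨⟨hxA, hx⟩, hxB⟩, rfl⟩
  refine ⟨⟨x, ⟨hxA, hxB⟩, rfl⟩, fun hgood => hx fun ε hε => ?_⟩
  have hcont : Continuous π := (LipschitzWith.of_dist_le_mul (K := 1)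
    (fun y a => by simpa using hπ1 y a)).continuous
  -- `ε / 2` compensates the Lipschitz constant `2` of the inverse chart.
  have h1 := (hcont.tendsto x).eventually (hgood (ε / 2) (by positivity))
  filter_upwards [nhdsWithin_le_nhds h1, self_mem_nhdsWithin,
    nhdsWithin_le_nhds (hBo.mem_nhds hxB)] with y hy hyM hyB
  obtain ⟨_, ⟨a, ⟨haA, haB⟩, rfl⟩, ha⟩ := hy
  refine ⟨a, haA, ?_⟩
  rw [← dist_eq_norm, ← dist_eq_norm]
  have h2 := hπ2 y ⟨hyM, hyB⟩ a ⟨hA haA, haB⟩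
  have h3 := hπ1 y x
  rw [NNReal.coe_ofNat] at h2
  have h4 := mul_le_mul_of_nonneg_left h3 (half_pos hε).le
  linarith

/-! ### Transfer of second order expansions -/

theorem abs_heightDefect_sub_heightDefect_le {n : ℕ} {x u : E n} {κ : Fin (n - 1) → ℝ}
    {e : Fin (n - 1) → E n} (he : ∀ i, ‖e i‖ = 1) (y a : E n) :
    |heightDefect x u κ e y - heightDefect x u κ e a| ≤
      |inner ℝ (y - a) u| + (∑ i, |κ i|) * (‖y - a‖ * (‖y - x‖ + ‖a - x‖)) := by
  have h1 : heightDefect x u κ e y - heightDefect x u κ e a = -inner ℝ (y - a) u -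
      (1 / 2) * ∑ i, κ i * (inner ℝ (e i) (y - a) *
        (inner ℝ (e i) (y - x) + inner ℝ (e i) (a - x))) := by
    have h2 : ∀ i, κ i * (inner ℝ (e i) (y - a) *
        (inner ℝ (e i) (y - x) + inner ℝ (e i) (a - x))) =
        κ i * inner ℝ (e i) (y - x) ^ 2 - κ i * inner ℝ (e i) (a - x) ^ 2 := by
      intro i
      rw [show y - a = (y - x) - (a - x) by abel, inner_sub_right]; ring
    rw [Finset.sum_congr rfl fun i _ => h2 i, Finset.sum_sub_distrib, heightDefect, heightDefect,
      inner_sub_left, inner_sub_left, inner_sub_left]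
    ring
  have h2 : |∑ i, κ i * (inner ℝ (e i) (y - a) *
        (inner ℝ (e i) (y - x) + inner ℝ (e i) (a - x)))| ≤
      (∑ i, |κ i|) * (‖y - a‖ * (‖y - x‖ + ‖a - x‖)) := by
    rw [Finset.sum_mul]
    refine (Finset.abs_sum_le_sum_abs _ _).trans (Finset.sum_le_sum fun i _ => ?_)
    have hb : ∀ v, |inner ℝ (e i) v| ≤ ‖v‖ := fun v => by
      simpa [he i] using abs_real_inner_le_norm (e i) v
    rw [abs_mul, abs_mul]
    have := (abs_add_le (inner ℝ (e i) (y - x)) (inner ℝ (e i) (a - x))).trans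
      (add_le_add (hb _) (hb _))
    gcongr
    exact hb _
  rw [h1]
  refine (abs_sub _ _).trans ?_
  rw [abs_neg, abs_mul, abs_of_pos (by norm_num : (0 : ℝ) < 1 / 2)]
  have := abs_nonneg (∑ i, κ i * (inner ℝ (e i) (y - a) *
        (inner ℝ (e i) (y - x) + inner ℝ (e i) (a - x))))
  linarith

/-- Replacing `y ∈ F` by a point of `A` at distance `ε ‖y - x‖` changes the defect by `O(ε ‖y -
x‖²)`, because both the height and the quadratic form have slopes of order `‖y - x‖`. -/
theorem hasSecondOrderExpansion_iff_of_firstOrderDense {n : ℕ} {A F : Set (E n)} {x u : E n}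
    (hAF : A ⊆ F) {C : ℝ} (hC : 0 ≤ C)
    (hF : ∀ y ∈ F, ∀ a ∈ F, |inner ℝ (y - a) u| ≤ C * (‖y - a‖ * (‖y - x‖ + ‖a - x‖)))
    (hd : FirstOrderDense A F x) (κ : Fin (n - 1) → ℝ) :
    HasSecondOrderExpansion F x u κ ↔ HasSecondOrderExpansion A x u κ := by
  refine and_congr_right fun _ => exists_congr fun e => and_congr_right fun he =>
    and_congr_right fun _ => ⟨fun h => h.mono (nhdsWithin_mono x hAF), fun h => ?_⟩
  refine isLittleO_iff.2 fun c hc => ?_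
  -- Since `‖a - x‖ ≤ 2 ‖y - x‖`, the value `c / 8` becomes `c / 2` at `y`; moving from `a` to `y`
  -- costs the other `c / 2` through `C' * ε`.
  have h1 := (isLittleO_iff.1 h) (c := c / 8) (by positivity)
  rw [Filter.Eventually, Metric.mem_nhdsWithin_iff] at h1
  obtain ⟨δ, hδ, h1⟩ := h1
  set C' := 3 * (C + ∑ i, |κ i|) with hC'
  have hκ0 : 0 ≤ ∑ i, |κ i| := Finset.sum_nonneg fun i _ => abs_nonneg _
  have hC'0 : 0 ≤ C' := by positivity
  set ε := min 1 (c / (2 * (C' + 1))) with hε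
  have hε0 : 0 < ε := lt_min one_pos (by positivity)
  have hεC : C' * ε ≤ c / 2 := by
    have h2 : ε ≤ c / (2 * (C' + 1)) := min_le_right _ _
    rw [le_div_iff₀ (by positivity)] at h2
    nlinarith
  filter_upwards [hd ε hε0, self_mem_nhdsWithin,
    nhdsWithin_le_nhds (ball_mem_nhds x (half_pos hδ))] with y hy hyF hyx
  obtain ⟨a, ha, hya⟩ := hy
  rw [mem_ball, dist_eq_norm] at hyx
  have hya1 : ‖y - a‖ ≤ ‖y - x‖ :=
    hya.trans (mul_le_of_le_one_left (norm_nonneg _) (min_le_left _ _))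
  have hax : ‖a - x‖ ≤ 2 * ‖y - x‖ := by
    calc ‖a - x‖ = ‖(y - x) - (y - a)‖ := by congr 1; abel
      _ ≤ ‖y - x‖ + ‖y - a‖ := norm_sub_le _ _
      _ ≤ _ := by linarith
  have h2 := h1 ⟨by rw [mem_ball, dist_eq_norm]; linarith, ha⟩
  change ‖heightDefect x u κ e a‖ ≤ c / 8 * ‖‖a - x‖ ^ 2‖ at h2
  change ‖heightDefect x u κ e y‖ ≤ c * ‖‖y - x‖ ^ 2‖
  rw [Real.norm_eq_abs, Real.norm_eq_abs, abs_of_nonneg (sq_nonneg ‖a - x‖)] at h2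
  rw [Real.norm_eq_abs, Real.norm_eq_abs, abs_of_nonneg (sq_nonneg ‖y - x‖)]
  have h3 := abs_heightDefect_sub_heightDefect_le (x := x) (u := u) (κ := κ) he.1 y a
  have h4 := hF y hyF a (hAF ha)
  have h5 : ‖y - a‖ * (‖y - x‖ + ‖a - x‖) ≤ (ε * ‖y - x‖) * (3 * ‖y - x‖) := by
    gcongr; linarith
  have h6 : (C + ∑ i, |κ i|) * (‖y - a‖ * (‖y - x‖ + ‖a - x‖)) ≤
      (C + ∑ i, |κ i|) * ((ε * ‖y - x‖) * (3 * ‖y - x‖)) :=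
    mul_le_mul_of_nonneg_left h5 (by positivity)
  have h7 : (C + ∑ i, |κ i|) * ((ε * ‖y - x‖) * (3 * ‖y - x‖)) = C' * ε * ‖y - x‖ ^ 2 := by
    rw [hC']; ring
  have h8 := mul_le_mul_of_nonneg_right hεC (sq_nonneg ‖y - x‖)
  have h9 : ‖a - x‖ ^ 2 ≤ 4 * ‖y - x‖ ^ 2 := by
    have := pow_le_pow_left₀ (norm_nonneg _) hax 2
    linarith [mul_pow 2 ‖y - x‖ 2]
  have h10 := abs_sub_abs_le_abs_sub (heightDefect x u κ e y) (heightDefect x u κ e a)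
  have h11 := mul_le_mul_of_nonneg_left h9 (by positivity : 0 ≤ c / 8)
  linarith

/-- `K` and `M` have the same normal and the same principal curvatures at `x`. -/
def SameShapeAt {n : ℕ} (K M : Set (E n)) (x : E n) : Prop :=
  outerNormal K x = outerNormal M x ∧ principalCurvature K x = principalCurvature M x

theorem isPrincipalCurvatures_iff_of_firstOrderDense {n : ℕ} {M A : Set (E n)} (hc : Convex ℝ M)
    (hcl : IsClosed M) {x u : E n} {r : ℝ} (hr : 0 < r) (hx : x ∈ frontier M)
    (hu : IsOuterUnitNormal M x u) (hb : closedBall (x - r • u) r ⊆ M) (hA : A ⊆ frontier M)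
    (hd : FirstOrderDense A (frontier M) x) :
    outerNormal M x = u ∧
      ∀ κ, IsPrincipalCurvatures M x κ ↔ HasSecondOrderExpansion A x u κ := by
  have h1 : outerNormal M x = u :=
    hu.eq_of_ball hr hb (hcl.frontier_subset hx) (outerNormal_spec hc hcl hx)
  refine ⟨h1, fun κ => ?_⟩
  rw [isPrincipalCurvatures_iff, h1]
  refine hasSecondOrderExpansion_iff_of_firstOrderDense hA (C := 2 / r) (by positivity)
    (fun y hy a ha => ?_) hd κ
  have := abs_inner_sub_le hc hcl hr hu hb hy ha
  rw [div_mul_eq_mul_div, le_div_iff₀ hr]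
  linarith

theorem sameShapeAt_of_firstOrderDense {n : ℕ} {K M A : Set (E n)} (hK : Convex ℝ K)
    (hKcl : IsClosed K) (hM : Convex ℝ M) (hMcl : IsClosed M) {x u : E n} {r r' : ℝ} (hr : 0 < r)
    (hr' : 0 < r') (hxK : x ∈ frontier K) (hxM : x ∈ frontier M)
    (huK : IsOuterUnitNormal K x u) (huM : IsOuterUnitNormal M x u)
    (hbK : closedBall (x - r • u) r ⊆ K) (hbM : closedBall (x - r' • u) r' ⊆ M)
    (hAK : A ⊆ frontier K) (hAM : A ⊆ frontier M)
    (hdK : FirstOrderDense A (frontier K) x) (hdM : FirstOrderDense A (frontier M) x) :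
    SameShapeAt K M x := by
  obtain ⟨h1, h2⟩ := isPrincipalCurvatures_iff_of_firstOrderDense hK hKcl hr hxK huK hbK hAK hdK
  obtain ⟨h3, h4⟩ := isPrincipalCurvatures_iff_of_firstOrderDense hM hMcl hr' hxM huM hbM hAM hdM
  exact ⟨h1.trans h3.symm, principalCurvature_congr fun κ => (h2 κ).trans (h4 κ).symm⟩

/-- By convexity a short initial piece of the segment from `x` to `y` lies in `M`, hence in `K`, and
the sign of the inner product is unchanged by scaling. -/
theorem isOuterUnitNormal_of_eventuallyEq {n : ℕ} {K M : Set (E n)} (hM : Convex ℝ M) {x u : E n}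
    (hx : x ∈ M) (h : K =ᶠ[𝓝 x] M) (hu : IsOuterUnitNormal K x u) : IsOuterUnitNormal M x u := by
  refine ⟨hu.1, fun y hy => ?_⟩
  have hlim : Tendsto (fun t : ℝ => x + t • (y - x)) (𝓝[>] 0) (𝓝 x) := by
    have : Tendsto (fun t : ℝ => x + t • (y - x)) (𝓝 0) (𝓝 (x + (0 : ℝ) • (y - x))) :=
      Continuous.tendsto (by fun_prop) 0
    rw [zero_smul, add_zero] at this
    exact this.mono_left nhdsWithin_le_nhds
  obtain ⟨t, h1, h2, h3⟩ := ((hlim.eventually h).and ((eventually_mem_nhdsWithin (a := (0 : ℝ)) (s := Ioi 0)).and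
    (nhdsWithin_le_nhds (Iio_mem_nhds (zero_lt_one (α := ℝ)))))).exists
  have ht0 : 0 < t := h2
  have ht1 : t < 1 := h3
  have h4 : x + t • (y - x) ∈ M := hM.add_smul_sub_mem hx hy ⟨ht0.le, ht1.le⟩
  have h5 : x + t • (y - x) ∈ K := (iff_of_eq h1).2 h4
  have h6 := hu.2 _ h5
  rw [add_sub_cancel_left, real_inner_smul_left] at h6
  by_contra! h7
  nlinarith

theorem frontier_eventuallyEq {X : Type*} [TopologicalSpace X] {K M : Set X} {x : X}
    (h : K =ᶠ[𝓝 x] M) : frontier K =ᶠ[𝓝 x] frontier M := by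
  obtain ⟨V, hV, hVo, hxV⟩ := eventually_nhds_iff.1 h
  have hKM : K ∩ V = M ∩ V := by
    ext y
    exact and_congr_left fun hy => iff_of_eq (hV y hy)
  have : frontier K ∩ V = frontier M ∩ V := by
    rw [← frontier_inter_open_inter hVo, hKM, frontier_inter_open_inter hVo]
  filter_upwards [hVo.mem_nhds hxV] with y hy
  have h1 := congrArg (y ∈ ·) this
  simp only [mem_inter_iff, hy, and_true] at h1
  exact h1

theorem sameShapeAt_of_eventuallyEq {n : ℕ} {K M : Set (E n)} (hK : Convex ℝ K) (hM : Convex ℝ M)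
    {x : E n} (hxK : x ∈ K) (hxM : x ∈ M) (h : K =ᶠ[𝓝 x] M) : SameShapeAt K M x := by
  have h1 : outerNormal K x = outerNormal M x := outerNormal_congr fun u =>
    ⟨isOuterUnitNormal_of_eventuallyEq hM hxM h, isOuterUnitNormal_of_eventuallyEq hK hxK h.symm⟩
  refine ⟨h1, principalCurvature_congr fun κ => ?_⟩
  rw [isPrincipalCurvatures_iff, isPrincipalCurvatures_iff, h1, HasSecondOrderExpansion,
    HasSecondOrderExpansion, nhdsWithin_eq_iff_eventuallyEq.2 (frontier_eventuallyEq h)]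

/-! ### Boundaries of the union and the intersection -/

/-- Some direction leaves both outer balls immediately. Without such balls this fails: two boxes
glued along a facet have common boundary points inside the union. -/
theorem frontier_inter_frontier_subset {n : ℕ} (hn : 2 ≤ n) {K L : Set (E n)} (hK : Convex ℝ K)
    (hKcl : IsClosed K) (hL : Convex ℝ L) (hLcl : IsClosed L)
    (hKo : AdmitsOuterRollingBall K) (hLo : AdmitsOuterRollingBall L) :
    frontier K ∩ frontier L ⊆ frontier (K ∪ L) := by
  rintro x ⟨hxK, hxL⟩
  refine ⟨subset_closure (Or.inl (hKcl.frontier_subset hxK)), fun hint => ?_⟩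
  obtain ⟨R, hR, hKR⟩ := hKo
  obtain ⟨R', hR', hLR⟩ := hLo
  have hu := outerNormal_spec hK hKcl hxK
  have hu' := outerNormal_spec hL hLcl hxL
  have hKR := hKR x hxK _ hu
  have hLR := hLR x hxL _ hu'
  set u := outerNormal K x
  set u' := outerNormal L x
  -- The sum of the normals works unless they are opposite; then any tangent direction does, which
  -- exists because `n ≥ 2`. A tangent ray also leaves a ball at once.
  obtain ⟨v, hv0, hvu, hvu'⟩ : ∃ v : E n, v ≠ 0 ∧ 0 ≤ inner ℝ v u ∧ 0 ≤ inner ℝ v u' := by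
    by_cases h : u + u' = 0
    · obtain ⟨b, hb⟩ := exists_orthonormalBasis_option (by omega) hu.1
      have i : Fin (n - 1) := ⟨0, by omega⟩
      have h0 : inner ℝ (b (some i)) u = 0 := by
        rw [← hb]; exact b.orthonormal.2 (by simp)
      refine ⟨b (some i), ?_, h0.ge, ?_⟩
      · rw [← norm_ne_zero_iff, b.orthonormal.1]; exact one_ne_zero
      · rw [eq_neg_of_add_eq_zero_right h, inner_neg_right, h0, neg_zero]
    · have h1 : -1 ≤ inner ℝ u u' := by
        have := (abs_le.1 (abs_real_inner_le_norm u u')).1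
        rwa [hu.1, hu'.1, mul_one] at this
      refine ⟨u + u', h, ?_, ?_⟩
      · rw [inner_add_left, real_inner_self_eq_norm_sq, hu.1, real_inner_comm]; linarith
      · rw [inner_add_left, real_inner_self_eq_norm_sq, hu'.1]; linarith
  have hout : ∀ (t ρ : ℝ) (w : E n), 0 < t → 0 < ρ → ‖w‖ = 1 → 0 ≤ inner ℝ v w →
      x + t • v ∉ closedBall (x - ρ • w) ρ := by
    intro t ρ w ht hρ hw hvw hmem
    rw [mem_closedBall, dist_eq_norm, show x + t • v - (x - ρ • w) = t • v + ρ • w by abel] at hmem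
    have h1 := pow_le_pow_left₀ (norm_nonneg _) hmem 2
    rw [norm_add_sq_real, real_inner_smul_left, real_inner_smul_right, norm_smul, norm_smul, hw,
      Real.norm_eq_abs, Real.norm_eq_abs, mul_pow, mul_one, sq_abs, sq_abs] at h1
    have h2 : 0 < t ^ 2 * ‖v‖ ^ 2 := by positivity
    have h3 : 0 ≤ t * (ρ * inner ℝ v w) := by positivity
    linarith
  have hlim : Tendsto (fun t : ℝ => x + t • v) (𝓝[>] 0) (𝓝 x) := by
    have : Tendsto (fun t : ℝ => x + t • v) (𝓝 0) (𝓝 (x + (0 : ℝ) • v)) :=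
      Continuous.tendsto (by fun_prop) 0
    rw [zero_smul, add_zero] at this
    exact this.mono_left nhdsWithin_le_nhds
  obtain ⟨t, h1, h2⟩ := ((hlim.eventually (mem_interior_iff_mem_nhds.1 hint)).and
    self_mem_nhdsWithin).exists
  rcases h1 with h1 | h1
  · exact hout t R u h2 hR hu.1 hvu (hKR h1)
  · exact hout t R' u' h2 hR' hu'.1 hvu' (hLR h1)

theorem frontier_union_eq {X : Type*} [TopologicalSpace X] {K L : Set X} (hK : IsClosed K)
    (hL : IsClosed L) (h : frontier K ∩ frontier L ⊆ frontier (K ∪ L)) :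
    frontier (K ∪ L) = frontier K \ L ∪ frontier L \ K ∪ frontier K ∩ frontier L := by
  have aux : ∀ {K L : Set X}, IsClosed L → frontier K \ L ⊆ frontier (K ∪ L) := by
    intro K L hL x hx
    have := frontier_inter_open_inter (s := K ∪ L) hL.isOpen_compl
    have h2 := frontier_inter_open_inter (s := K) hL.isOpen_compl
    rw [union_inter_distrib_right, inter_compl_self, union_empty, h2] at this
    exact ((Set.ext_iff.1 this x).1 hx).1
  apply Subset.antisymm
  · intro x hx
    have hxKL : x ∈ K ∪ L := (hK.union hL).frontier_subset hx
    have hK' : x ∉ interior K := fun h' => hx.2 (interior_mono subset_union_left h')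
    have hL' : x ∉ interior L := fun h' => hx.2 (interior_mono subset_union_right h')
    rw [hK.frontier_eq, hL.frontier_eq]
    by_cases h1 : x ∈ K <;> by_cases h2 : x ∈ L
    · exact Or.inr ⟨⟨h1, hK'⟩, h2, hL'⟩
    · exact Or.inl (Or.inl ⟨⟨h1, hK'⟩, h2⟩)
    · exact Or.inl (Or.inr ⟨⟨h2, hL'⟩, h1⟩)
    · exact absurd hxKL (by simp [h1, h2])
  · refine union_subset (union_subset (aux hL) ?_) h
    rw [union_comm]; exact aux hK

theorem frontier_inter_eq {X : Type*} [TopologicalSpace X] {K L : Set X} (hK : IsClosed K)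
    (hL : IsClosed L) : frontier (K ∩ L) =
      frontier K ∩ interior L ∪ frontier L ∩ interior K ∪ frontier K ∩ frontier L := by
  rw [(hK.inter hL).frontier_eq, interior_inter, hK.frontier_eq, hL.frontier_eq]
  ext x
  have h1 : x ∈ interior K → x ∈ K := fun h => interior_subset h
  have h2 : x ∈ interior L → x ∈ L := fun h => interior_subset h
  simp only [Set.mem_sdiff, mem_inter_iff, mem_union]
  tauto

theorem frontier_eq_union {X : Type*} [TopologicalSpace X] {K L : Set X} (hL : IsClosed L) :
    frontier K = frontier K \ L ∪ frontier K ∩ interior L ∪ frontier K ∩ frontier L := by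
  rw [hL.frontier_eq]
  ext x
  have h2 : x ∈ interior L → x ∈ L := fun h => interior_subset h
  simp only [Set.mem_sdiff, mem_inter_iff, mem_union]
  tauto

theorem FirstOrderDense.of_subset_union {n : ℕ} {A F G H : Set (E n)} {x : E n}
    (hF : FirstOrderDense A F x) (hG : FirstOrderDense A G x) (h : H ⊆ F ∪ G) :
    FirstOrderDense A H x := fun ε hε => by
  refine nhdsWithin_mono x h ?_
  rw [nhdsWithin_union]
  exact Filter.mem_sup.2 ⟨hF ε hε, hG ε hε⟩

/-! ### Agreement of normals and curvatures -/

theorem exists_closedBall_subset_of_mem_rollingBodies {n : ℕ} {K : ConvexBody (E n)}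
    (hK : K ∈ rollingBodies n) : ∃ r : ℝ, 0 < r ∧ ∀ x ∈ frontier (K : Set (E n)),
      closedBall (x - r • outerNormal (K : Set (E n)) x) r ⊆ (K : Set (E n)) := by
  obtain ⟨-, ⟨r, hr, h⟩, -⟩ := hK
  exact ⟨r, hr, fun x hx => h x hx _ (outerNormal_spec K.convex K.isClosed hx)⟩

/-- At almost every common boundary point of `K` and `L`, the bodies `K`, `L`, their union and
their intersection have the same normal and the same principal curvatures. -/
theorem ae_sameShapeAt {n : ℕ} (hn : 2 ≤ n) {K L U I : ConvexBody (E n)}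
    (hK : K ∈ rollingBodies n) (hL : L ∈ rollingBodies n)
    (hU : (U : Set (E n)) = (K : Set (E n)) ∪ L) (hI : (I : Set (E n)) = (K : Set (E n)) ∩ L) :
    ∀ᵐ x ∂(μHE[n - 1] : Measure (E n)), x ∈ frontier (K : Set (E n)) ∩ frontier (L : Set (E n)) →
      SameShapeAt (L : Set (E n)) K x ∧ SameShapeAt (U : Set (E n)) K x ∧
        SameShapeAt (I : Set (E n)) K x := by
  have hsub : frontier (K : Set (E n)) ∩ frontier (L : Set (E n)) ⊆ frontier (U : Set (E n)) := by
    rw [hU]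
    exact frontier_inter_frontier_subset hn K.convex K.isClosed L.convex L.isClosed hK.2.2 hL.2.2
  have hUf : frontier (U : Set (E n)) ⊆ frontier (K : Set (E n)) ∪ frontier (L : Set (E n)) := by
    rw [hU, frontier_union_eq K.isClosed L.isClosed (hU ▸ hsub)]
    rintro x ((h | h) | h)
    exacts [Or.inl h.1, Or.inr h.1, Or.inl h.1]
  have hsubI : frontier (K : Set (E n)) ∩ frontier (L : Set (E n)) ⊆ frontier (I : Set (E n)) := by
    rw [hI, frontier_inter_eq K.isClosed L.isClosed]
    exact subset_union_right
  have hIf : frontier (I : Set (E n)) ⊆ frontier (K : Set (E n)) ∪ frontier (L : Set (E n)) := by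
    rw [hI, frontier_inter_eq K.isClosed L.isClosed]
    rintro x ((h | h) | h)
    exacts [Or.inl h.1, Or.inr h.1, Or.inl h.1]
  obtain ⟨r, hr, hbK⟩ := exists_closedBall_subset_of_mem_rollingBodies hK
  obtain ⟨r', hr', hbL⟩ := exists_closedBall_subset_of_mem_rollingBodies hL
  have h1 := ae_firstOrderDense (by omega) K.convex K.isClosed hr hbK
    (inter_subset_left : frontier (K : Set (E n)) ∩ frontier (L : Set (E n)) ⊆ _)
  have h2 := ae_firstOrderDense (by omega) L.convex L.isClosed hr' hbL
    (inter_subset_right : frontier (K : Set (E n)) ∩ frontier (L : Set (E n)) ⊆ _)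
  rw [measure_eq_zero_iff_ae_notMem] at h1 h2
  filter_upwards [h1, h2] with x hx1 hx2 hx
  have hdK : FirstOrderDense (frontier (K : Set (E n)) ∩ frontier (L : Set (E n)))
      (frontier (K : Set (E n))) x := by
    by_contra h; exact hx1 ⟨hx, h⟩
  have hdL : FirstOrderDense (frontier (K : Set (E n)) ∩ frontier (L : Set (E n)))
      (frontier (L : Set (E n))) x := by
    by_contra h; exact hx2 ⟨hx, h⟩
  -- A normal of the union supports each of the bodies, so by uniqueness it is the normal of both
  -- `K` and `L`.
  have huU := outerNormal_spec U.convex U.isClosed (hsub hx)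
  set u := outerNormal (U : Set (E n)) x
  have huK : IsOuterUnitNormal (K : Set (E n)) x u :=
    ⟨huU.1, fun y hy => huU.2 y (hU ▸ Or.inl hy)⟩
  have huL : IsOuterUnitNormal (L : Set (E n)) x u :=
    ⟨huU.1, fun y hy => huU.2 y (hU ▸ Or.inr hy)⟩
  have huI : IsOuterUnitNormal (I : Set (E n)) x u :=
    ⟨huU.1, fun y hy => huK.2 y (hI ▸ hy : y ∈ (K : Set (E n)) ∩ L).1⟩
  have heqK : u = outerNormal (K : Set (E n)) x :=
    (outerNormal_spec K.convex K.isClosed hx.1).eq_of_ball hr (hbK x hx.1)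
      (K.isClosed.frontier_subset hx.1) huK
  have heqL : u = outerNormal (L : Set (E n)) x :=
    (outerNormal_spec L.convex L.isClosed hx.2).eq_of_ball hr' (hbL x hx.2)
      (L.isClosed.frontier_subset hx.2) huL
  have hbK' := hbK x hx.1
  have hbL' := hbL x hx.2
  rw [← heqK] at hbK'
  rw [← heqL] at hbL'
  have hmin : 0 < min r r' := lt_min hr hr'
  have hball : ∀ ρ, min r r' ≤ ρ →
      closedBall (x - min r r' • u) (min r r') ⊆ closedBall (x - ρ • u) ρ := by
    intro ρ hρ
    refine closedBall_subset_closedBall' ?_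
    rw [dist_eq_norm, show x - min r r' • u - (x - ρ • u) = (ρ - min r r') • u by
      rw [sub_smul]; abel, norm_smul, huU.1, Real.norm_eq_abs, abs_of_nonneg (by linarith)]
    linarith
  -- `U` and `I` are not assumed to have rolling balls. At this one point `I` contains the smaller
  -- of the two touching balls, and `U` that of `K`.
  have hbI : closedBall (x - min r r' • u) (min r r') ⊆ (I : Set (E n)) := by
    rw [hI]
    exact subset_inter ((hball r (min_le_left _ _)).trans hbK')
      ((hball r' (min_le_right _ _)).trans hbL')
  refine ⟨?_, ?_, ?_⟩
  · exact sameShapeAt_of_firstOrderDense L.convex L.isClosed K.convex K.isClosed hr' hr hx.2 hx.1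
      huL huK hbL' hbK' inter_subset_right inter_subset_left hdL hdK
  · exact sameShapeAt_of_firstOrderDense U.convex U.isClosed K.convex K.isClosed hr hr (hsub hx)
      hx.1 huU huK (hbK'.trans (hU ▸ subset_union_left)) hbK' hsub inter_subset_left
      (hdK.of_subset_union hdL hUf) hdK
  · exact sameShapeAt_of_firstOrderDense I.convex I.isClosed K.convex K.isClosed hmin hr
      (hsubI hx) hx.1 huI huK hbI hbK' hsubI inter_subset_left (hdK.of_subset_union hdL hIf) hdK

theorem sameShapeAt_of_notMem {n : ℕ} {K L U : ConvexBody (E n)}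
    (hU : (U : Set (E n)) = (K : Set (E n)) ∪ L) {x : E n} (hxK : x ∈ (K : Set (E n)))
    (hxL : x ∉ (L : Set (E n))) : SameShapeAt (U : Set (E n)) K x := by
  refine sameShapeAt_of_eventuallyEq U.convex K.convex (hU ▸ Or.inl hxK) hxK ?_
  filter_upwards [L.isClosed.isOpen_compl.mem_nhds hxL] with y hy
  refine propext ⟨fun h => ?_, fun h => ?_⟩
  · have h' : y ∈ (K : Set (E n)) ∪ L := hU ▸ h
    exact h'.resolve_right hy
  · have h' : y ∈ (K : Set (E n)) ∪ L := Or.inl h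
    exact hU ▸ h'

theorem sameShapeAt_of_mem_interior {n : ℕ} {K L I : ConvexBody (E n)}
    (hI : (I : Set (E n)) = (K : Set (E n)) ∩ L) {x : E n} (hxK : x ∈ (K : Set (E n)))
    (hxL : x ∈ interior (L : Set (E n))) : SameShapeAt (I : Set (E n)) K x := by
  refine sameShapeAt_of_eventuallyEq I.convex K.convex (hI ▸ ⟨hxK, interior_subset hxL⟩) hxK ?_
  filter_upwards [mem_interior_iff_mem_nhds.1 hxL] with y hy
  refine propext ⟨fun h => ?_, fun h => ?_⟩
  · have h' : y ∈ (K : Set (E n)) ∩ L := hI ▸ h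
    exact h'.1
  · have h' : y ∈ (K : Set (E n)) ∩ L := ⟨h, hy⟩
    exact hI ▸ h'

/-! ### The valuation identity -/

theorem setLIntegral_union₃ {X : Type*} [MeasurableSpace X] {μ : Measure X} {P Q A : Set X}
    (hQ : MeasurableSet Q) (hA : MeasurableSet A) (hPQ : Disjoint P Q) (hPA : Disjoint P A)
    (hQA : Disjoint Q A) (f : X → ENNReal) :
    ∫⁻ x in P ∪ Q ∪ A, f x ∂μ = ∫⁻ x in P, f x ∂μ + ∫⁻ x in Q, f x ∂μ + ∫⁻ x in A, f x ∂μ := by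
  rw [lintegral_union hA (disjoint_union_left.2 ⟨hPA, hQA⟩), lintegral_union hQ hPQ]

theorem setIntegral_union₃ {X : Type*} [MeasurableSpace X] {μ : Measure X} {P Q A : Set X}
    (hQ : MeasurableSet Q) (hA : MeasurableSet A) (hPQ : Disjoint P Q) (hPA : Disjoint P A)
    (hQA : Disjoint Q A) {f : X → ℝ} (hfP : IntegrableOn f P μ) (hfQ : IntegrableOn f Q μ)
    (hfA : IntegrableOn f A μ) :
    ∫ x in P ∪ Q ∪ A, f x ∂μ = ∫ x in P, f x ∂μ + ∫ x in Q, f x ∂μ + ∫ x in A, f x ∂μ := by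
  rw [setIntegral_union (disjoint_union_left.2 ⟨hPA, hQA⟩) hA (hfP.union hfQ) hfA,
    setIntegral_union hPQ hQ hfP hfQ]

section Disjointness
variable {X : Type*} [TopologicalSpace X] {K L : Set X}

theorem disjoint_frontier_diff_frontier_diff (hK : IsClosed K) :
    Disjoint (frontier K \ L) (frontier L \ K) :=
  Set.disjoint_left.2 fun _ h h' => h'.2 (hK.frontier_subset h.1)

theorem disjoint_frontier_diff_frontier_inter (hL : IsClosed L) :
    Disjoint (frontier K \ L) (frontier K ∩ frontier L) :=
  Set.disjoint_left.2 fun _ h h' => h.2 (hL.frontier_subset h'.2)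

theorem disjoint_frontier_diff_inter_interior :
    Disjoint (frontier K \ L) (frontier K ∩ interior L) :=
  Set.disjoint_left.2 fun _ h h' => h.2 (interior_subset h'.2)

theorem disjoint_frontier_inter_interior_frontier_inter :
    Disjoint (frontier K ∩ interior L) (frontier K ∩ frontier L) :=
  Set.disjoint_left.2 fun _ h h' => h'.2.2 h.2

theorem disjoint_frontier_inter_interior :
    Disjoint (frontier K ∩ interior L) (frontier L ∩ interior K) :=
  Set.disjoint_left.2 fun _ h h' => h.1.2 h'.2

end Disjointness

/-- The boundaries of `K`, `L`, `K ∪ L` and `K ∩ L` are composed of five common pieces, on each of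
which the bodies concerned have the same normals and principal curvatures. -/
theorem exists_frontier_decomposition {n : ℕ} (hn : 2 ≤ n) {K L U I : ConvexBody (E n)}
    (hK : K ∈ rollingBodies n) (hL : L ∈ rollingBodies n)
    (hU : (U : Set (E n)) = (K : Set (E n)) ∪ L) (hI : (I : Set (E n)) = (K : Set (E n)) ∩ L) :
    ∃ P₁ P₂ P₃ P₄ A : Set (E n),
      (MeasurableSet P₁ ∧ MeasurableSet P₂ ∧ MeasurableSet P₃ ∧ MeasurableSet P₄ ∧
        MeasurableSet A) ∧
      (Disjoint P₁ A ∧ Disjoint P₂ A ∧ Disjoint P₃ A ∧ Disjoint P₄ A) ∧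
      (Disjoint P₁ P₂ ∧ Disjoint P₃ P₄ ∧ Disjoint P₁ P₃ ∧ Disjoint P₂ P₄) ∧
      (frontier (U : Set (E n)) = P₁ ∪ P₂ ∪ A ∧ frontier (I : Set (E n)) = P₃ ∪ P₄ ∪ A ∧
        frontier (K : Set (E n)) = P₁ ∪ P₃ ∪ A ∧ frontier (L : Set (E n)) = P₂ ∪ P₄ ∪ A) ∧
      (∀ x ∈ P₁, SameShapeAt (U : Set (E n)) K x) ∧ (∀ x ∈ P₂, SameShapeAt (U : Set (E n)) L x) ∧
      (∀ x ∈ P₃, SameShapeAt (I : Set (E n)) K x) ∧ (∀ x ∈ P₄, SameShapeAt (I : Set (E n)) L x) ∧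
      ∀ᵐ x ∂(μHE[n - 1] : Measure (E n)), x ∈ A → SameShapeAt (L : Set (E n)) K x ∧
        SameShapeAt (U : Set (E n)) K x ∧ SameShapeAt (I : Set (E n)) K x := by
  have hae := ae_sameShapeAt hn hK hL hU hI
  have hsub := frontier_inter_frontier_subset hn K.convex K.isClosed L.convex L.isClosed
    hK.2.2 hL.2.2
  have hUf := frontier_union_eq K.isClosed L.isClosed hsub
  have hIf := frontier_inter_eq K.isClosed L.isClosed
  rw [← hU] at hUf
  rw [← hI] at hIf
  have hKf := frontier_eq_union (K := (K : Set (E n))) L.isClosed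
  have hLf := frontier_eq_union (K := (L : Set (E n))) K.isClosed
  rw [inter_comm (frontier (L : Set (E n))) (frontier (K : Set (E n)))] at hLf
  have mK : MeasurableSet (K : Set (E n)) := K.isClosed.measurableSet
  have mL : MeasurableSet (L : Set (E n)) := L.isClosed.measurableSet
  have mfK : MeasurableSet (frontier (K : Set (E n))) := isClosed_frontier.measurableSet
  have mfL : MeasurableSet (frontier (L : Set (E n))) := isClosed_frontier.measurableSet
  have hU' : (U : Set (E n)) = (L : Set (E n)) ∪ K := by rw [hU, union_comm]
  have hI' : (I : Set (E n)) = (L : Set (E n)) ∩ K := by rw [hI, inter_comm]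
  have dUL := disjoint_frontier_diff_frontier_inter (K := (L : Set (E n))) K.isClosed
  have dIL := disjoint_frontier_inter_interior_frontier_inter (K := (L : Set (E n)))
    (L := (K : Set (E n)))
  rw [inter_comm (frontier (L : Set (E n))) (frontier (K : Set (E n)))] at dUL dIL
  exact ⟨_, _, _, _, _, ⟨mfK.diff mL, mfL.diff mK, mfK.inter isOpen_interior.measurableSet,
      mfL.inter isOpen_interior.measurableSet, mfK.inter mfL⟩,
    ⟨disjoint_frontier_diff_frontier_inter L.isClosed, dUL,
      disjoint_frontier_inter_interior_frontier_inter, dIL⟩,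
    ⟨disjoint_frontier_diff_frontier_diff K.isClosed, disjoint_frontier_inter_interior,
      disjoint_frontier_diff_inter_interior, disjoint_frontier_diff_inter_interior⟩,
    ⟨hUf, hIf, hKf, hLf⟩,
    fun x hx => sameShapeAt_of_notMem hU (K.isClosed.frontier_subset hx.1) hx.2,
    fun x hx => sameShapeAt_of_notMem hU' (L.isClosed.frontier_subset hx.1) hx.2,
    fun x hx => sameShapeAt_of_mem_interior hI (K.isClosed.frontier_subset hx.1) hx.2,
    fun x hx => sameShapeAt_of_mem_interior hI' (L.isClosed.frontier_subset hx.1) hx.2, hae⟩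

/-- A functional of a set and a point that depends on the set only through its normal and its
principal curvatures at the point. -/
def IsShapeLocal {n : ℕ} {M : Type*} (f : Set (E n) → E n → M) : Prop :=
  ∀ K L x, SameShapeAt K L x → f K x = f L x

/-- Both sides become the integrals over the four outer pieces plus twice that over `A`. Only the
pieces need to be measurable, not `f`. -/
theorem isValuationOn_lintegral {n : ℕ} (hn : 2 ≤ n) {f : Set (E n) → E n → ENNReal}
    (hf : IsShapeLocal f) : IsValuationOn (rollingBodies n)
      (fun K => ∫⁻ x in frontier (K : Set (E n)), f K x ∂μHE[n - 1]) := by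
  intro K hK L hL U I hU hI
  obtain ⟨P₁, P₂, P₃, P₄, A, ⟨m1, m2, m3, m4, mA⟩, ⟨d1, d2, d3, d4⟩, ⟨d12, d34, d13, d24⟩,
    ⟨hUf, hIf, hKf, hLf⟩, h1, h2, h3, h4, hae⟩ := exists_frontier_decomposition hn hK hL hU hI
  beta_reduce
  rw [hUf, hIf, hKf, hLf, setLIntegral_union₃ m2 mA d12 d1 d2, setLIntegral_union₃ m4 mA d34 d3 d4,
    setLIntegral_union₃ m3 mA d13 d1 d3, setLIntegral_union₃ m4 mA d24 d2 d4,
    setLIntegral_congr_fun m1 fun x hx => hf _ _ _ (h1 x hx),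
    setLIntegral_congr_fun m2 fun x hx => hf _ _ _ (h2 x hx),
    setLIntegral_congr_fun m3 fun x hx => hf _ _ _ (h3 x hx),
    setLIntegral_congr_fun m4 fun x hx => hf _ _ _ (h4 x hx),
    setLIntegral_congr_fun_ae mA (hae.mono fun x h hx => hf _ _ _ (h hx).1),
    setLIntegral_congr_fun_ae mA (hae.mono fun x h hx => hf _ _ _ (h hx).2.1),
    setLIntegral_congr_fun_ae mA (hae.mono fun x h hx => hf _ _ _ (h hx).2.2)]
  ring

theorem isValuationOn_integral {n : ℕ} (hn : 2 ≤ n) {f : Set (E n) → E n → ℝ}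
    (hf : IsShapeLocal f) {𝒮 : Set (ConvexBody (E n))} (h𝒮 : 𝒮 ⊆ rollingBodies n)
    (hint : ∀ K ∈ 𝒮, IntegrableOn (f K) (frontier (K : Set (E n))) μHE[n - 1]) :
    IsValuationOn 𝒮 (fun K => ∫ x in frontier (K : Set (E n)), f K x ∂μHE[n - 1]) := by
  intro K hK L hL U I hU hI
  obtain ⟨P₁, P₂, P₃, P₄, A, ⟨m1, m2, m3, m4, mA⟩, ⟨d1, d2, d3, d4⟩, ⟨d12, d34, d13, d24⟩,
    ⟨hUf, hIf, hKf, hLf⟩, h1, h2, h3, h4, hae⟩ :=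
      exists_frontier_decomposition hn (h𝒮 hK) (h𝒮 hL) hU hI
  have iK := hint K hK
  have iL := hint L hL
  rw [hKf, integrableOn_union, integrableOn_union] at iK
  rw [hLf, integrableOn_union, integrableOn_union] at iL
  obtain ⟨⟨iK1, iK3⟩, iKA⟩ := iK
  obtain ⟨⟨iL2, iL4⟩, iLA⟩ := iL
  -- `U` and `I` need not belong to `𝒮`; their integrability is inherited piecewise from `K` and
  -- `L`.
  have iU1 : IntegrableOn (f U) P₁ μHE[n - 1] :=
    iK1.congr_fun (fun x hx => (hf _ _ _ (h1 x hx)).symm) m1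
  have iU2 : IntegrableOn (f U) P₂ μHE[n - 1] :=
    iL2.congr_fun (fun x hx => (hf _ _ _ (h2 x hx)).symm) m2
  have iI3 : IntegrableOn (f I) P₃ μHE[n - 1] :=
    iK3.congr_fun (fun x hx => (hf _ _ _ (h3 x hx)).symm) m3
  have iI4 : IntegrableOn (f I) P₄ μHE[n - 1] :=
    iL4.congr_fun (fun x hx => (hf _ _ _ (h4 x hx)).symm) m4
  have iUA : IntegrableOn (f U) A μHE[n - 1] := iKA.congr_fun_ae
    ((ae_restrict_iff' mA).2 (hae.mono fun x h hx => (hf _ _ _ (h hx).2.1).symm))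
  have iIA : IntegrableOn (f I) A μHE[n - 1] := iKA.congr_fun_ae
    ((ae_restrict_iff' mA).2 (hae.mono fun x h hx => (hf _ _ _ (h hx).2.2).symm))
  beta_reduce
  rw [hUf, hIf, hKf, hLf, setIntegral_union₃ m2 mA d12 d1 d2 iU1 iU2 iUA,
    setIntegral_union₃ m4 mA d34 d3 d4 iI3 iI4 iIA, setIntegral_union₃ m3 mA d13 d1 d3 iK1 iK3 iKA,
    setIntegral_union₃ m4 mA d24 d2 d4 iL2 iL4 iLA,
    setIntegral_congr_fun m1 fun x hx => hf _ _ _ (h1 x hx),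
    setIntegral_congr_fun m2 fun x hx => hf _ _ _ (h2 x hx),
    setIntegral_congr_fun m3 fun x hx => hf _ _ _ (h3 x hx),
    setIntegral_congr_fun m4 fun x hx => hf _ _ _ (h4 x hx),
    setIntegral_congr_ae mA (hae.mono fun x h hx => hf _ _ _ (h hx).1),
    setIntegral_congr_ae mA (hae.mono fun x h hx => hf _ _ _ (h hx).2.1),
    setIntegral_congr_ae mA (hae.mono fun x h hx => hf _ _ _ (h hx).2.2)]
  ring

/-! ### Integrability -/

theorem continuousOn_outerNormal {n : ℕ} {K : Set (E n)} (hc : Convex ℝ K) (hcl : IsClosed K)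
    {r : ℝ} (hr : 0 < r)
    (hb : ∀ x ∈ frontier K, closedBall (x - r • outerNormal K x) r ⊆ K) :
    ContinuousOn (outerNormal K) (frontier K) := by
  refine (LipschitzOnWith.of_dist_le' (K := 2 / r) fun y hy x hx => ?_).continuousOn
  have := norm_outerNormal_sub_le hr (outerNormal_spec hc hcl hx) (hb x hx)
    (hcl.frontier_subset hy) (outerNormal_spec hc hcl hy)
  rw [dist_eq_norm, dist_eq_norm, div_mul_eq_mul_div, le_div_iff₀ hr]
  linarith

/-- The integrand is measurable and bounded on a boundary of finite measure: `φ` is continuous on a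
compact set and `g` is evaluated on the box `[0, 2/r]^{n-1}`. -/
theorem integrableOn_mul_comp_principalCurvature {n : ℕ} (hn : 1 ≤ n) {K : ConvexBody (E n)}
    (hK : K ∈ rollingBodies n) {φ : E n → ℝ} (hφ : ContinuousOn φ (frontier (K : Set (E n))))
    {g : (Fin (n - 1) → ℝ) → ℝ} (hg : Continuous g) :
    IntegrableOn (fun x => φ x * g (principalCurvature (K : Set (E n)) x))
      (frontier (K : Set (E n))) μHE[n - 1] := by
  obtain ⟨r, hr, hb⟩ := exists_closedBall_subset_of_mem_rollingBodies hK
  have hcpt : IsCompact (frontier (K : Set (E n))) :=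
    K.isCompact.of_isClosed_subset isClosed_frontier K.isClosed.frontier_subset
  have hm : MeasurableSet (frontier (K : Set (E n))) := isClosed_frontier.measurableSet
  have hfin := euclideanHausdorffMeasure_frontier_lt_top hn K.isCompact K.convex hr hb
  obtain ⟨C, hC⟩ := hcpt.exists_bound_of_continuousOn hφ
  obtain ⟨D, hD⟩ := (isCompact_Icc (a := (0 : Fin (n - 1) → ℝ))
    (b := fun _ => 2 / r)).exists_bound_of_continuousOn hg.continuousOn
  have hmeas : AEStronglyMeasurable (fun x => φ x * g (principalCurvature (K : Set (E n)) x))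
      ((μHE[n - 1] : Measure (E n)).restrict (frontier (K : Set (E n)))) := by
    refine (hφ.aestronglyMeasurable hm).mul ?_
    have h1 := hg.measurable.comp
      (measurable_indicator_principalCurvature hn K.isCompact K.convex hr hb)
    refine h1.aestronglyMeasurable.congr ?_
    filter_upwards [ae_restrict_mem hm] with x hx
    simp [indicator_of_mem hx]
  refine IntegrableOn.of_bound hfin hmeas (C * D) ?_
  filter_upwards [ae_restrict_mem hm] with x hx
  rw [norm_mul]
  have h1 := hC x hx
  have h2 := hD _ (principalCurvature_mem_Icc K.convex K.isClosed hx hr (hb x hx))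
  exact mul_le_mul h1 h2 (norm_nonneg _) ((norm_nonneg _).trans h1)

/-- A ball of radius `ρ` about the origin inside `K` forces the support value to be at least `ρ`. -/
theorem inner_outerNormal_pos {n : ℕ} {K : Set (E n)} (hc : Convex ℝ K) (hcl : IsClosed K)
    (h0 : (0 : E n) ∈ interior K) {x : E n} (hx : x ∈ frontier K) :
    0 < inner ℝ x (outerNormal K x) := by
  obtain ⟨ρ, hρ, hball⟩ := Metric.nhds_basis_closedBall.mem_iff.1 (mem_interior_iff_mem_nhds.1 h0)
  have hu := outerNormal_spec hc hcl hx
  have h1 := hu.2 (ρ • outerNormal K x) (hball (by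
    rw [mem_closedBall, dist_zero_right, norm_smul, hu.1, Real.norm_eq_abs, abs_of_pos hρ,
      mul_one]))
  rw [inner_sub_left, real_inner_smul_left, real_inner_self_eq_norm_sq, hu.1] at h1
  linarith

theorem isShapeLocal_curvatureIntegrand {n : ℕ} (p : ℝ) (m k : ℕ) {j : ℕ} (i : Fin j → Fin (n - 1))
    (α : Fin j → ℝ) : IsShapeLocal (curvatureIntegrand p m k i α) := fun K L x h => by
  rw [curvatureIntegrand, curvatureIntegrand, gaussCurvature, gaussCurvature, h.1, h.2]

theorem isShapeLocal_mixedAffineIntegrand {n : ℕ} (p s : ℝ) :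
    IsShapeLocal (mixedAffineIntegrand (n := n) p s) := fun K L x h => by
  rw [mixedAffineIntegrand, mixedAffineIntegrand, gaussCurvature, gaussCurvature, h.1, h.2]

theorem integrableOn_curvatureIntegrand {n : ℕ} (hn : 1 ≤ n) {p : ℝ} (hp : 0 ≤ p ∨ p < -(n : ℝ))
    (m k : ℕ) {j : ℕ} (i : Fin j → Fin (n - 1)) {α : Fin j → ℝ} (hα : ∀ l, 0 ≤ α l)
    {K : ConvexBody (E n)} (hK : K ∈ rollingBodies n)
    (h0 : (0 : E n) ∈ interior (K : Set (E n))) :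
    IntegrableOn (curvatureIntegrand p m k i α (K : Set (E n)))
      (frontier (K : Set (E n))) μHE[n - 1] := by
  -- The range of `p` is what makes this exponent nonnegative, hence the power continuous where the
  -- Gauss curvature vanishes. The power of `⟨x, N⟩` may be negative; there positivity is used
  -- instead.
  have hpn : 0 ≤ p / (n + p) := by
    rcases hp with hp | hp
    · positivity
    · have : (0 : ℝ) ≤ n := Nat.cast_nonneg n
      exact div_nonneg_of_nonpos (by linarith) (by linarith)
  obtain ⟨r, hr, hb⟩ := exists_closedBall_subset_of_mem_rollingBodies hK
  have hφ : ContinuousOn (fun x => inner ℝ x (outerNormal (K : Set (E n)) x) ^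
      ((m : ℝ) - (k : ℝ) + n * (1 - p) / (n + p))) (frontier (K : Set (E n))) := by
    refine ContinuousOn.rpow_const
      (continuousOn_id.inner (continuousOn_outerNormal K.convex K.isClosed hr hb)) fun x hx => ?_
    exact Or.inl (inner_outerNormal_pos K.convex K.isClosed h0 hx).ne'
  have hg : Continuous fun κ : Fin (n - 1) → ℝ =>
      (∏ i, κ i) ^ (p / (n + p)) * ∏ l, κ (i l) ^ α l := by
    refine Continuous.mul ?_ (continuous_finsetProd _ fun l _ => ?_)
    · exact (continuous_finsetProd _ fun l _ => continuous_apply l).rpow_const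
        fun _ => Or.inr hpn
    · exact (continuous_apply (i l)).rpow_const fun _ => Or.inr (hα l)
  refine (integrableOn_mul_comp_principalCurvature hn hK hφ hg).congr_fun (fun x _ => ?_)
    isClosed_frontier.measurableSet
  simp only [curvatureIntegrand, gaussCurvature]
  ring

theorem integrableOn_mixedAffineIntegrand {n : ℕ} (hn : 1 ≤ n) {s : ℝ} (hs : 0 ≤ s)
    {K : ConvexBody (E n)} (hK : K ∈ rollingBodies n) :
    IntegrableOn (mixedAffineIntegrand 1 s (K : Set (E n)))
      (frontier (K : Set (E n))) μHE[n - 1] := by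
  have hg : Continuous fun κ : Fin (n - 1) → ℝ => (∏ i, κ i) ^ ((s + 1) / ((n : ℝ) + 1)) :=
    (continuous_finsetProd _ fun l _ => continuous_apply l).rpow_const
      fun _ => Or.inr (by positivity)
  refine (integrableOn_mul_comp_principalCurvature hn hK (φ := fun _ => 1) continuousOn_const
    hg).congr_fun (fun x _ => ?_) isClosed_frontier.measurableSet
  -- For `p = 1` the exponent of `⟨x, N⟩` is `0` and that factor is `1`, so the origin may lie on
  -- the boundary.
  simp [mixedAffineIntegrand, gaussCurvature]

end LpSteiner

theorem mainTheorem3 (n : ℕ) (hn : 2 ≤ n) :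
    (∀ p : ℝ, (0 ≤ p ∨ p < -(n : ℝ)) → ∀ m k j : ℕ, ∀ i : Fin j → Fin (n - 1), ∀ α : Fin j → ℝ,
      (∀ l, 0 ≤ α l) →
        -- valuation on the whole class, with values in `[0, ∞]`
        LpSteiner.IsValuationOn (LpSteiner.rollingBodies n)
          (fun K => ∫⁻ x in frontier (K : Set (LpSteiner.E n)),
            ENNReal.ofReal (LpSteiner.curvatureIntegrand p m k i α (K : Set (LpSteiner.E n)) x)
              ∂μHE[n - 1]) ∧
        -- finite, hence a real valuation, on the bodies with the origin in the interior
        (∀ K ∈ LpSteiner.rollingBodies n, (0 : LpSteiner.E n) ∈ interior (K : Set (LpSteiner.E n)) →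
          IntegrableOn (LpSteiner.curvatureIntegrand p m k i α (K : Set (LpSteiner.E n)))
            (frontier (K : Set (LpSteiner.E n))) μHE[n - 1]) ∧
        LpSteiner.IsValuationOn
          {K ∈ LpSteiner.rollingBodies n |
            (0 : LpSteiner.E n) ∈ interior (K : Set (LpSteiner.E n))}
          (fun K => ∫ x in frontier (K : Set (LpSteiner.E n)),
            LpSteiner.curvatureIntegrand p m k i α (K : Set (LpSteiner.E n)) x ∂μHE[n - 1])) ∧
    (∀ s : ℝ, 0 ≤ s →
      (∀ K ∈ LpSteiner.rollingBodies n,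
        IntegrableOn (LpSteiner.mixedAffineIntegrand 1 s (K : Set (LpSteiner.E n)))
          (frontier (K : Set (LpSteiner.E n))) μHE[n - 1]) ∧
      LpSteiner.IsValuationOn (LpSteiner.rollingBodies n)
        (LpSteiner.mixedAffineSurfaceArea 1 s)) := by
  refine ⟨fun p hp m k j i α hα => ⟨?_, ?_, ?_⟩, fun s hs => ⟨?_, ?_⟩⟩
  · exact LpSteiner.isValuationOn_lintegral hn
      (f := fun K x => ENNReal.ofReal (LpSteiner.curvatureIntegrand p m k i α K x))
      fun K L x h => congrArg ENNReal.ofReal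
        (LpSteiner.isShapeLocal_curvatureIntegrand p m k i α K L x h)
  · exact fun K hK h0 =>
      LpSteiner.integrableOn_curvatureIntegrand (by omega) hp m k i hα hK h0
  · exact LpSteiner.isValuationOn_integral hn
      (LpSteiner.isShapeLocal_curvatureIntegrand p m k i α) (fun K hK => hK.1) fun K hK =>
        LpSteiner.integrableOn_curvatureIntegrand (by omega) hp m k i hα hK.1 hK.2
  · exact fun K hK => LpSteiner.integrableOn_mixedAffineIntegrand (by omega) hs hK
  · exact LpSteiner.isValuationOn_integral hn (LpSteiner.isShapeLocal_mixedAffineIntegrand 1 s)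
      subset_rfl fun K hK => LpSteiner.integrableOn_mixedAffineIntegrand (by omega) hs hK
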